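/- Let $\mathbb{K}=\mathbb{R}$ or $\mathbb{C}$, let $H$ be a separable Hilbert space over $\mathbb{K}$, and let $A:\operatorname{dom}(A)\to H$ be a (possibly unbounded, densely defined) self-adjoint operator on $H$. A projection-valued measure on $\operatorname{Borel}(\mathbb{R})$ is a map $P$ assigning to each Borel set $V\subseteq\mathbb{R}$ an orthogonal projection $P(V)$ on $H$ such that $P(\emptyset)=0$, $P(\mathbb{R})=\operatorname{id}$, $P(V_1\cap V_2)=P(V_1)P(V_2)$ for all Borel $V_1,V_2$, and $P(\bigsqcup_n V_n)x=\sum_n P(V_n)x$ for every $x\in H$ and every sequence $(V_n)$ of pairwise disjoint Borel sets. Put $\mu_{x,y}(V)=(P(V)x,y)$. For Borel measurable $f:\mathbb{R}\to\mathbb{R}$, $\int_{\mathbb{R}} f\,dP$ denotes the operator with domain $\{x\in H : \int_{\mathbb{R}}|f|^2\,d\mu_{x,x}<\infty\}$ such that, for all $x$ in this domain and all $y\in H$, $f$ is $|\mu_{y,x}|$-integrable and $\bigl(y,(\int_{\mathbb{R}} f\,dP)x\bigr)=\int_{\mathbb{R}} f\,d\mu_{y,x}$. **Theorem (Spectral resolution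 theorem).** There exists a projection-valued measure $P$ on $\operatorname{Borel}(\mathbb{R})$ such that $$A=\int_{\mathbb{R}}\operatorname{id}\,dP .$$ Moreover, let $(\Omega,\mathcal{A},\mu)$ be any probability space, $m:\Omega\to\mathbb{R}$ a measurable function, $T$ the operator of multiplication by $m$ on $L_2(\Omega,\mu)=L_2(\Omega,\mu;\mathbb{K})$ with domain $\{f\in L_2(\Omega,\mu): mf\in L_2(\Omega,\mu)\}$, and $U:H\to L_2(\Omega,\mu)$ a linear isometry such that $T\circ U$ extends $U\circ A$. Let $\hat P(V)f=\mathbf{1}_{m^{-1}(V)}\cdot f$ for Borel $V\subseteq\mathbb{R}$ and $f\in L_2(\Omega,\mu)$. Then $P(V):=U^*\hat P(V)U$ defines a projection-valued measure on $\operatorname{Borel}(\mathbb{R})$, acting on $H$, with $A=\int_{\mathbb{R}}\operatorname{id}\,dP$. -/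

import Mathlib

open MeasureTheory Set
open scoped ENNReal

noncomputable section

/-- A projection-valued measure on the Borel sets of `ℝ`, acting on `H`: orthogonal projections
`P V`, countably additive in the strong operator topology. As for Mathlib's `VectorMeasure`, the
function is extended by `0` to the sets that are not Borel. -/
structure ProjectionValuedMeasure (𝕜 H : Type*) [RCLike 𝕜] [NormedAddCommGroup H]
    [InnerProductSpace 𝕜 H] [CompleteSpace H] where
  /-- the underlying set function -/
  toFun : Set ℝ → H →L[𝕜] H
  not_measurable' : ∀ V, ¬ MeasurableSet V → toFun V = 0
  isStarProjection' : ∀ V, MeasurableSet V → IsStarProjection (toFun V)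
  empty' : toFun ∅ = 0
  univ' : toFun univ = ContinuousLinearMap.id 𝕜 H
  inter' : ∀ V W, MeasurableSet V → MeasurableSet W → toFun (V ∩ W) = toFun V ∘L toFun W
  hasSum' : ∀ V : ℕ → Set ℝ, (∀ n, MeasurableSet (V n)) → Pairwise (Function.onFun Disjoint V) →
    ∀ x : H, HasSum (fun n => toFun (V n) x) (toFun (⋃ n, V n) x)

namespace ProjectionValuedMeasure

variable {𝕜 H : Type*} [RCLike 𝕜] [NormedAddCommGroup H] [InnerProductSpace 𝕜 H]
  [CompleteSpace H]

/-- The `𝕜`-valued measure `μ_{x,y} : V ↦ ⟪P V x, y⟫`. -/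
def scalarMeasure (P : ProjectionValuedMeasure 𝕜 H) (x y : H) : VectorMeasure ℝ 𝕜 where
  measureOf' V := inner 𝕜 (P.toFun V x) y
  empty' := by simp [P.empty']
  not_measurable' V hV := by simp [P.not_measurable' V hV]
  m_iUnion' V hV hd := by
    have h := (P.hasSum' V hV hd x).mapL (innerSL 𝕜 y)
    have h2 := h.mapL (RCLike.conjCLE (K := 𝕜)).toContinuousLinearMap
    simpa using h2

theorem inner_apply_self (P : ProjectionValuedMeasure 𝕜 H) {V : Set ℝ} (hV : MeasurableSet V)
    (x : H) : inner 𝕜 (P.toFun V x) x = ((‖P.toFun V x‖ ^ 2 : ℝ) : 𝕜) := by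
  have h := P.isStarProjection' V hV
  have h1 : P.toFun V (P.toFun V x) = P.toFun V x := by
    have := congrArg (fun T : H →L[𝕜] H => T x) h.isIdempotentElem.eq
    simpa using this
  have h2 : inner 𝕜 (P.toFun V (P.toFun V x)) x = inner 𝕜 (P.toFun V x) (P.toFun V x) := by
    have h3 := ContinuousLinearMap.adjoint_inner_left (P.toFun V) x (P.toFun V x)
    have h4 : ContinuousLinearMap.adjoint (P.toFun V) = P.toFun V := h.isSelfAdjoint
    rwa [h4] at h3
  rw [h1] at h2
  rw [h2, inner_self_eq_norm_sq_to_K]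
  push_cast
  rfl

/-- The positive finite measure `μ_{x,x} : V ↦ ⟪P V x, x⟫`, as a measure with values in
`[0, ∞]`. -/
def diagMeasure (P : ProjectionValuedMeasure 𝕜 H) (x : H) : Measure ℝ :=
  Measure.ofMeasurable (fun V _ => ENNReal.ofReal (RCLike.re (inner 𝕜 (P.toFun V x) x)))
    (by simp [P.empty'])
    (by
      intro V hV hd
      have h := (P.scalarMeasure x x).m_iUnion hV hd
      have h2 : HasSum (fun n => RCLike.re (inner 𝕜 (P.toFun (V n) x) x))
          (RCLike.re (inner 𝕜 (P.toFun (⋃ n, V n) x) x)) :=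
        h.mapL (RCLike.reCLM (K := 𝕜))
      rw [← h2.tsum_eq, ENNReal.ofReal_tsum_of_nonneg _ h2.summable]
      intro n
      rw [P.inner_apply_self (hV n), RCLike.ofReal_re]
      positivity)

/-- `P.IsIntegral f T` says that `T` is the operator `∫ f dP`: its domain consists of the `x` with
`∫ |f|² dμ_{x,x} < ∞`, and for such `x` and every `y`, `f` is integrable with respect to (the total
variation of) `μ_{y,x}` and `⟪y, T x⟫ = ∫ f dμ_{y,x}`. -/
def IsIntegral (P : ProjectionValuedMeasure 𝕜 H) (f : ℝ → ℝ) (T : H →ₗ.[𝕜] H) : Prop :=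
  (∀ x : H, x ∈ T.domain ↔ ∫⁻ t, ‖f t‖ₑ ^ 2 ∂(P.diagMeasure x) < ∞) ∧
  ∀ (x : T.domain) (y : H), (P.scalarMeasure y x).Integrable f ∧
    inner 𝕜 y (T x) = ∫ᵛ t, f t ∂•(P.scalarMeasure y x)

/-- There is at most one operator `∫ f dP`. -/
theorem IsIntegral.unique {P : ProjectionValuedMeasure 𝕜 H} {f : ℝ → ℝ} {T T' : H →ₗ.[𝕜] H}
    (h : P.IsIntegral f T) (h' : P.IsIntegral f T') : T = T' := by
  refine LinearPMap.ext (Submodule.ext fun x => (h.1 x).trans (h'.1 x).symm) ?_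
  intro x hx hx'
  refine ext_inner_left 𝕜 fun y => ?_
  rw [(h.2 ⟨x, hx⟩ y).2, (h'.2 ⟨x, hx'⟩ y).2]

end ProjectionValuedMeasure

section Multiplication

variable (𝕜 : Type*) {Ω : Type*} [RCLike 𝕜] [MeasurableSpace Ω]

/-- The maximal operator of multiplication by the real function `m` on `L²(Ω, μ)`: its domain
consists of the `f ∈ L²` with `m f ∈ L²`. -/
def multiplicationOperator (μ : Measure Ω) (m : Ω → ℝ) : Lp 𝕜 2 μ →ₗ.[𝕜] Lp 𝕜 2 μ where
  domain :=
    { carrier := {f | MemLp (fun ω => (m ω : 𝕜) * f ω) 2 μ}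
      zero_mem' := by
        refine (MemLp.zero (ε := 𝕜)).ae_eq ?_
        filter_upwards [Lp.coeFn_zero 𝕜 2 μ] with ω hω
        rw [hω, Pi.zero_apply, mul_zero]
      add_mem' := by
        intro f g hf hg
        refine (MemLp.add hf hg).ae_eq ?_
        filter_upwards [Lp.coeFn_add f g] with ω hω
        rw [hω, Pi.add_apply, Pi.add_apply, mul_add]
      smul_mem' := by
        intro c f hf
        refine (MemLp.const_smul hf c).ae_eq ?_
        filter_upwards [Lp.coeFn_smul c f] with ω hω
        rw [hω, Pi.smul_apply, Pi.smul_apply, smul_eq_mul, smul_eq_mul, mul_left_comm] }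
  toFun :=
    { toFun := fun f => MemLp.toLp _ f.2
      map_add' := by
        intro f g
        rw [← MemLp.toLp_add]
        refine MemLp.toLp_congr _ _ ?_
        filter_upwards [Lp.coeFn_add f.1 g.1] with ω hω
        rw [Submodule.coe_add, hω, Pi.add_apply, Pi.add_apply, mul_add]
      map_smul' := by
        intro c f
        refine (MemLp.toLp_congr _ (MemLp.const_smul f.2 c) ?_).trans
          (MemLp.toLp_const_smul c f.2)
        filter_upwards [Lp.coeFn_smul c f.1] with ω hω
        rw [Submodule.coe_smul, hω, Pi.smul_apply, Pi.smul_apply, smul_eq_mul, smul_eq_mul,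
          mul_left_comm] }

theorem multiplicationOperator_ae (μ : Measure Ω) (m : Ω → ℝ)
    (f : (multiplicationOperator 𝕜 μ m).domain) :
    (multiplicationOperator 𝕜 μ m f : Ω → 𝕜) =ᵐ[μ] fun ω => (m ω : 𝕜) * (f : Lp 𝕜 2 μ) ω := by
  have hf : MemLp (fun ω => (m ω : 𝕜) * (f : Lp 𝕜 2 μ) ω) 2 μ := f.2
  have h : multiplicationOperator 𝕜 μ m f = MemLp.toLp _ hf := rfl
  rw [h]
  exact MemLp.coeFn_toLp hf

/-- The linear map `f ↦ 1_S · f` on `L²(Ω, μ)`, for a measurable set `S`. -/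
def indicatorLinearMap (μ : Measure Ω) {S : Set Ω} (hS : MeasurableSet S) :
    Lp 𝕜 2 μ →ₗ[𝕜] Lp 𝕜 2 μ where
  toFun f := MemLp.toLp (S.indicator f) ((Lp.memLp f).indicator hS)
  map_add' f g := by
    rw [← MemLp.toLp_add]
    refine MemLp.toLp_congr _ _ ?_
    filter_upwards [Lp.coeFn_add f g] with ω hω
    rw [Pi.add_apply]
    by_cases h : ω ∈ S
    · rw [indicator_of_mem h, indicator_of_mem h, indicator_of_mem h, hω, Pi.add_apply]
    · rw [indicator_of_notMem h, indicator_of_notMem h, indicator_of_notMem h, add_zero]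
  map_smul' c f := by
    have hf : MemLp (S.indicator f) 2 μ := (Lp.memLp f).indicator hS
    have hcf : MemLp (S.indicator (c • f : Lp 𝕜 2 μ)) 2 μ := (Lp.memLp (c • f)).indicator hS
    have h2 : MemLp.toLp _ (hf.const_smul c) = c • MemLp.toLp _ hf := MemLp.toLp_const_smul c hf
    have h1 : MemLp.toLp _ hcf = MemLp.toLp _ (hf.const_smul c) := by
      refine MemLp.toLp_congr _ _ ?_
      filter_upwards [Lp.coeFn_smul c f] with ω hω
      rw [Pi.smul_apply]
      by_cases h : ω ∈ S
      · rw [indicator_of_mem h, indicator_of_mem h, hω, Pi.smul_apply]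
      · rw [indicator_of_notMem h, indicator_of_notMem h, smul_zero]
    exact h1.trans h2

theorem norm_indicatorLinearMap_le (μ : Measure Ω) {S : Set Ω} (hS : MeasurableSet S)
    (f : Lp 𝕜 2 μ) : ‖indicatorLinearMap 𝕜 μ hS f‖ ≤ 1 * ‖f‖ := by
  rw [one_mul]
  have hf : MemLp (S.indicator f) 2 μ := (Lp.memLp f).indicator hS
  have h : ‖MemLp.toLp _ hf‖ ≤ ‖f‖ := by
    refine Lp.norm_le_norm_of_ae_le ?_
    filter_upwards [MemLp.coeFn_toLp hf] with ω hω
    rw [hω]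
    exact norm_indicator_le_norm_self _ _
  exact h

/-- The bounded operator `f ↦ 1_S · f` on `L²(Ω, μ)`, for a measurable set `S`. -/
def indicatorOperator (μ : Measure Ω) {S : Set Ω} (hS : MeasurableSet S) :
    Lp 𝕜 2 μ →L[𝕜] Lp 𝕜 2 μ :=
  (indicatorLinearMap 𝕜 μ hS).mkContinuous 1 (norm_indicatorLinearMap_le 𝕜 μ hS)

theorem indicatorOperator_ae (μ : Measure Ω) {S : Set Ω} (hS : MeasurableSet S) (f : Lp 𝕜 2 μ) :
    (indicatorOperator 𝕜 μ hS f : Ω → 𝕜) =ᵐ[μ] S.indicator f := by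
  have hf : MemLp (S.indicator f) 2 μ := (Lp.memLp f).indicator hS
  have h : indicatorOperator 𝕜 μ hS f = MemLp.toLp _ hf := rfl
  rw [h]
  exact MemLp.coeFn_toLp hf

end Multiplication

end

/-! The second assertion rests on one fact: the range of `U` is invariant under multiplication by
every `1_{m⁻¹ V}`. Self-adjointness makes `1 + A²` onto, so each `x` equals `a + A b` with `b = A
a`. As `U` intertwines `A` with `m`, multiplication by `1/(1+m²)` and by `m/(1+m²)` sends `U x` to
`U a` and to `U b`. The bounded functions that preserve the closed range of `U` form an algebra
stable under bounded pointwise limits, hence contain all `1_{m⁻¹ V}`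
(`isMultiplier_indicator_preimage`). Then `U P(V) = 1_{m⁻¹ V} U`, and the axioms for `P` follow
pointwise. Moreover `μ_{x,y}` is the image under `m` of the density `⟪U x, U y⟫`, so the integral
formula is a computation in `L²`. The domain is right because `m · U x ∈ L²` puts `x` in the domain
of `A* = A`.

The first assertion follows once some `U` and `m` exist
(`IsSelfAdjoint.exists_multiplication_model`). Put `R = (1+A²)⁻¹`, `C = A R`, and let `h_k` be a
Hilbert basis. Diagonalizing the compression of `A` to a finite-dimensional `K ⊆ dom A` that
contains some of the `R h_k` and `C h_k` gives a discrete measure on a fixed compact space, whose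
coordinates record `1/(1+t²)`, `t/(1+t²)` and the values of the `h_k`. The moments involving `R` and
`C` are already exact, and the Gram matrix converges as `K` grows (`exists_finite_model`). A weak
limit has all the right moments (`exists_model`), and these force `U R = r U` and `U C = c U`
(`ae_eq_mul_of_inner_eq`). Then `m = c / r`. -/

noncomputable section

open Filter Topology

/-! ### Integration against a density, and bounded convergence in `L²`. -/

section Measure

variable {𝕜 Ω : Type*} [RCLike 𝕜] [MeasurableSpace Ω] {μ : Measure Ω}

/-- Integrability with respect to a measure with vector density. -/
theorem integrable_withDensityᵥ_iff {h : Ω → 𝕜} (hh : Integrable h μ) {f : Ω → ℝ}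
    (hf : Measurable f) :
    (μ.withDensityᵥ h).Integrable f ↔ Integrable (fun ω => f ω • h ω) μ := by
  rw [VectorMeasure.Integrable, Measure.variation_withDensityᵥ hh]
  have hnn : (fun ω => ‖h ω‖ₑ) = fun ω => ((‖h ω‖₊ : NNReal) : ℝ≥0∞) := rfl
  rw [hnn, integrable_withDensity_iff_integrable_smul₀ hh.aestronglyMeasurable.nnnorm.aemeasurable]
  refine integrable_congr' ?_ ?_ ?_
  · exact hh.aestronglyMeasurable.norm.smul hf.aestronglyMeasurable
  · exact hf.aestronglyMeasurable.smul hh.aestronglyMeasurable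
  · exact Eventually.of_forall fun ω => by simp [norm_smul, NNReal.smul_def, mul_comm]

/-- Clear for indicators, hence for simple functions by additivity. The general case is dominated
convergence on both sides along simple approximations bounded by `2|f|`. -/
theorem integral_withDensityᵥ {h : Ω → 𝕜} (hh : Integrable h μ) {f : Ω → ℝ}
    (hf : Measurable f) (hfh : Integrable (fun ω => f ω • h ω) μ) :
    ∫ᵛ ω, f ω ∂•(μ.withDensityᵥ h) = ∫ ω, f ω • h ω ∂μ := by
  have hvar : (μ.withDensityᵥ h).variation = μ.withDensity fun ω => ‖h ω‖ₑ :=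
    Measure.variation_withDensityᵥ hh
  have hfin : IsFiniteMeasure (μ.withDensityᵥ h).variation := by
    rw [hvar]
    exact isFiniteMeasure_withDensity hh.2.ne
  have hsimple : ∀ g : SimpleFunc Ω ℝ, (μ.withDensityᵥ h).Integrable g ∧
      Integrable (fun ω => g ω • h ω) μ ∧
      ∫ᵛ ω, g ω ∂•(μ.withDensityᵥ h) = ∫ ω, g ω • h ω ∂μ := by
    intro g
    have h1 : (μ.withDensityᵥ h).Integrable g := SimpleFunc.integrable_of_isFiniteMeasure g
    refine ⟨h1, (integrable_withDensityᵥ_iff hh g.measurable).1 h1, ?_⟩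
    induction g using SimpleFunc.induction with
    | const c hs =>
      rename_i s
      have h2 : (fun ω => (SimpleFunc.piecewise s hs (SimpleFunc.const Ω c)
          (SimpleFunc.const Ω 0)) ω • h ω) = s.indicator fun ω => c • h ω := by
        ext ω
        by_cases hω : ω ∈ s <;> simp [hω]
      rw [h2, integral_indicator hs, integral_smul, ← withDensityᵥ_apply hh hs]
      have h3 : (fun ω => (SimpleFunc.piecewise s hs (SimpleFunc.const Ω c)
          (SimpleFunc.const Ω 0)) ω) = s.indicator fun _ => c := by
        ext ω
        by_cases hω : ω ∈ s <;> simp [hω]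
      rw [h3, VectorMeasure.integral_indicator hs]
      rw [VectorMeasure.setIntegral_const]
      rfl
    | add hd hf1 hg1 =>
      rename_i f1 g1
      have a1 : (μ.withDensityᵥ h).Integrable f1 := SimpleFunc.integrable_of_isFiniteMeasure f1
      have a2 : (μ.withDensityᵥ h).Integrable g1 := SimpleFunc.integrable_of_isFiniteMeasure g1
      simp only [SimpleFunc.coe_add, Pi.add_apply, add_smul]
      rw [VectorMeasure.integral_fun_add a1 a2, hf1 a1, hg1 a2, integral_add
        ((integrable_withDensityᵥ_iff hh f1.measurable).1 a1)
        ((integrable_withDensityᵥ_iff hh g1.measurable).1 a2)]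
  have hfi : (μ.withDensityᵥ h).Integrable f := (integrable_withDensityᵥ_iff hh hf).2 hfh
  let φ := SimpleFunc.approxOn f hf univ 0 (mem_univ 0)
  have hφ : ∀ ω, Tendsto (fun n => φ n ω) atTop (𝓝 (f ω)) := fun ω =>
    SimpleFunc.tendsto_approxOn hf _ (by simp)
  have hb : ∀ n ω, ‖φ n ω‖ ≤ ‖f ω‖ + ‖f ω‖ := fun n ω =>
    SimpleFunc.norm_approxOn_zero_le hf _ ω n
  have t1 : Tendsto (fun n => ∫ᵛ ω, φ n ω ∂•(μ.withDensityᵥ h)) atTop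
      (𝓝 (∫ᵛ ω, f ω ∂•(μ.withDensityᵥ h))) :=
    VectorMeasure.tendsto_integral_of_dominated_convergence (fun ω => ‖f ω‖ + ‖f ω‖)
      (fun n => (hsimple (φ n)).1.aestronglyMeasurable) (hfi.norm.add hfi.norm)
      (fun n => Eventually.of_forall (hb n)) (Eventually.of_forall hφ)
  have t2 : Tendsto (fun n => ∫ ω, φ n ω • h ω ∂μ) atTop (𝓝 (∫ ω, f ω • h ω ∂μ)) := by
    refine tendsto_integral_of_dominated_convergence (fun ω => ‖f ω • h ω‖ + ‖f ω • h ω‖)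
      (fun n => (hsimple (φ n)).2.1.aestronglyMeasurable) (hfh.norm.add hfh.norm)
      (fun n => Eventually.of_forall fun ω => ?_)
      (Eventually.of_forall fun ω => (hφ ω).smul_const _)
    rw [norm_smul, norm_smul, ← add_mul]
    gcongr
    exact hb n ω
  refine tendsto_nhds_unique t1 (t2.congr fun n => (hsimple (φ n)).2.2.symm)

/-- Dominated convergence with majorant `(2M)² |F|²`. The filter is kept general because it is
applied both along `ℕ` and along finite subsets of `ℕ`. -/
theorem Lp_two_tendsto_of_bounded_mul {ι : Type*} {l : Filter ι} [l.IsCountablyGenerated] [l.NeBot]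
    {f : ι → Ω → ℝ} {g : Ω → ℝ} {M : ℝ} (hf : ∀ i, Measurable (f i))
    (hM : ∀ i ω, |f i ω| ≤ M) (hlim : ∀ ω, Tendsto (fun i => f i ω) l (𝓝 (g ω)))
    {F G : Lp 𝕜 2 μ} {Φ : ι → Lp 𝕜 2 μ}
    (hΦ : ∀ i, Φ i =ᵐ[μ] fun ω => (f i ω : 𝕜) * F ω) (hG : G =ᵐ[μ] fun ω => (g ω : 𝕜) * F ω) :
    Tendsto Φ l (𝓝 G) := by
  have hg : Measurable g := measurable_of_tendsto_metrizable' l hf (tendsto_pi_nhds.2 hlim)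
  have hgM : ∀ ω, |g ω| ≤ M := fun ω =>
    le_of_tendsto (hlim ω).abs (Eventually.of_forall fun i => hM i ω)
  rw [Lp.tendsto_Lp_iff_tendsto_eLpNorm']
  have hF2 : ∫⁻ ω, ‖F ω‖ₑ ^ (2 : ℝ) ∂μ < ∞ := by
    have := lintegral_rpow_enorm_lt_top_of_eLpNorm_lt_top (p := 2) (by norm_num) (by norm_num)
      (Lp.memLp F).2
    simpa using this
  have key : Tendsto (fun i => ∫⁻ ω, ‖f i ω - g ω‖ₑ ^ (2 : ℝ) * ‖F ω‖ₑ ^ (2 : ℝ) ∂μ) l (𝓝 0) := by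
    have h0 : (0 : ℝ≥0∞) = ∫⁻ ω : Ω, 0 ∂μ := by simp
    rw [h0]
    refine tendsto_lintegral_filter_of_dominated_convergence'
      (fun ω => ENNReal.ofReal (2 * M) ^ (2 : ℝ) * ‖F ω‖ₑ ^ (2 : ℝ)) ?_ ?_ ?_ ?_
    · refine Eventually.of_forall fun i => ?_
      exact (((hf i).sub hg).enorm.pow_const _).aemeasurable.mul
        ((Lp.aestronglyMeasurable F).enorm.pow_const _)
    · refine Eventually.of_forall fun i => Eventually.of_forall fun ω => ?_
      gcongr
      rw [Real.enorm_eq_ofReal_abs]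
      refine ENNReal.ofReal_le_ofReal ?_
      have h1 := hM i ω
      have h2 := hgM ω
      rw [abs_le] at *
      constructor <;> linarith [h1.1, h1.2, h2.1, h2.2]
    · rw [lintegral_const_mul'' _ ((Lp.aestronglyMeasurable F).enorm.pow_const _)]
      exact ENNReal.mul_ne_top (by finiteness) hF2.ne
    · have hFfin : ∀ᵐ ω ∂μ, ‖F ω‖ₑ ^ (2 : ℝ) ≠ ∞ := by
        refine Eventually.of_forall fun ω => ?_
        finiteness
      filter_upwards [hFfin] with ω hω
      have h1 : Tendsto (fun i => f i ω - g ω) l (𝓝 0) := by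
        simpa using (hlim ω).sub_const (g ω)
      have h2 : Tendsto (fun i => ‖f i ω - g ω‖ₑ ^ (2 : ℝ)) l (𝓝 0) := by
        have := (ENNReal.continuous_rpow_const (y := 2)).tendsto _ |>.comp h1.enorm
        simpa [Function.comp_def] using this
      simpa using ENNReal.Tendsto.mul_const h2 (Or.inr hω)
  have hnorm : ∀ i, eLpNorm (⇑(Φ i) - ⇑G) 2 μ
      = (∫⁻ ω, ‖f i ω - g ω‖ₑ ^ (2 : ℝ) * ‖F ω‖ₑ ^ (2 : ℝ) ∂μ) ^ (1 / (2 : ℝ)) := by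
    intro i
    rw [eLpNorm_eq_lintegral_rpow_enorm_toReal (by norm_num) (by norm_num)]
    simp only [ENNReal.toReal_ofNat]
    congr 1
    refine lintegral_congr_ae ?_
    filter_upwards [hΦ i, hG] with ω h1 h2
    rw [Pi.sub_apply, h1, h2, ← sub_mul, enorm_mul, ENNReal.mul_rpow_of_nonneg _ _ (by norm_num),
      ← RCLike.ofReal_sub]
    congr 2
    exact congrArg _ (NNReal.eq (RCLike.norm_ofReal _))
  simp_rw [hnorm]
  have := (ENNReal.continuous_rpow_const (y := 1 / (2 : ℝ))).tendsto _ |>.comp key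
  simpa [Function.comp_def] using this

theorem lintegral_enorm_sq_eq_norm_sq (F : Lp 𝕜 2 μ) :
    ∫⁻ ω, ‖F ω‖ₑ ^ 2 ∂μ = ENNReal.ofReal (‖F‖ ^ 2) := by
  have h := eLpNorm_nnreal_pow_eq_lintegral (μ := μ) (f := F) (p := 2) (by norm_num)
  rw [Lp.norm_def, ← ENNReal.toReal_pow, ENNReal.ofReal_toReal]
  · simpa using h.symm
  · exact ENNReal.pow_ne_top (Lp.eLpNorm_ne_top F)

end Measure

/-! ### Self-adjoint operators and their graphs. -/

section SelfAdjoint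

variable {𝕜 H : Type*} [RCLike 𝕜] [NormedAddCommGroup H] [InnerProductSpace 𝕜 H] [CompleteSpace H]
  {A : H →ₗ.[𝕜] H}

/-- Maximality of `A`: a weak solution lies in the domain of `A*`, which is that of `A`. -/
theorem IsSelfAdjoint.exists_apply_eq (hA : IsSelfAdjoint A) {y w : H}
    (h : ∀ x : A.domain, inner 𝕜 w (x : H) = inner 𝕜 y (A x)) :
    ∃ hy : y ∈ A.domain, A ⟨y, hy⟩ = w := by
  have h1 : ∃ hy : y ∈ A.adjoint.domain, A.adjoint ⟨y, hy⟩ = w :=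
    ⟨LinearPMap.mem_adjoint_domain_of_exists y ⟨w, h⟩,
      LinearPMap.adjoint_apply_eq hA.dense_domain _ h⟩
  rwa [LinearPMap.isSelfAdjoint_def.1 hA] at h1

theorem IsSelfAdjoint.inner_apply (hA : IsSelfAdjoint A) (x y : A.domain) :
    inner 𝕜 (A x) (y : H) = inner 𝕜 (x : H) (A y) := by
  have h := LinearPMap.adjoint_isFormalAdjoint hA.dense_domain
  rw [LinearPMap.isSelfAdjoint_def.1 hA] at h
  exact h x y

/-- The operator `1 + A²` is onto. -/
theorem IsSelfAdjoint.exists_add_apply_apply_eq (hA : IsSelfAdjoint A) (x : H) :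
    ∃ a b : A.domain, A a = b ∧ (a : H) + A b = x := by
  let e := WithLp.prodContinuousLinearEquiv 2 𝕜 H H
  let G : Submodule 𝕜 (WithLp 2 (H × H)) := A.graph.comap (e : WithLp 2 (H × H) →ₗ[𝕜] H × H)
  have hG : IsClosed (G : Set (WithLp 2 (H × H))) :=
    IsClosed.preimage e.continuous hA.isClosed
  have : CompleteSpace G := hG.completeSpace_coe
  -- Split `(x, 0)` as `(a, A a) + v` with `v` orthogonal to the closed graph. Orthogonality says `A
  -- v.snd = -v.fst`, so `b = -v.snd` satisfies `A a = b` and `a + A b = x`.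
  obtain ⟨u, hu, v, hv, huv⟩ := G.exists_add_mem_mem_orthogonal (WithLp.toLp 2 (x, 0))
  obtain ⟨a, ha1, ha2⟩ := (LinearPMap.mem_graph_iff A).1 (show e u ∈ A.graph from hu)
  have hv' : ∀ d : A.domain, inner 𝕜 (-v.fst) (d : H) = inner 𝕜 v.snd (A d) := by
    intro d
    have hd : WithLp.toLp 2 ((d : H), A d) ∈ G := LinearPMap.mem_graph A d
    have h1 := (Submodule.mem_orthogonal' G v).1 hv _ hd
    rw [WithLp.prod_inner_apply] at h1
    rw [inner_neg_left]
    exact neg_eq_of_add_eq_zero_right h1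
  obtain ⟨hb, hb'⟩ := hA.exists_apply_eq hv'
  have h1 : x = u.fst + v.fst := congrArg WithLp.fst huv
  have h2 : (0 : H) = u.snd + v.snd := congrArg WithLp.snd huv
  refine ⟨a, -⟨v.snd, hb⟩, ?_, ?_⟩
  · rw [ha2]
    exact (eq_neg_of_add_eq_zero_left h2.symm : u.snd = -v.snd)
  · rw [A.map_neg, hb', neg_neg, h1, ha1]
    rfl

end SelfAdjoint

/-! ### Functions that multiply the range of an isometry into itself. -/

section Multiplier

variable {𝕜 H Ω : Type*} [RCLike 𝕜] [NormedAddCommGroup H] [InnerProductSpace 𝕜 H]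
  [MeasurableSpace Ω] {μ : Measure Ω}

/-- The bounded measurable functions on `Ω` that multiply the range of `U` into itself. -/
structure IsMultiplier (U : H →ₗᵢ[𝕜] Lp 𝕜 2 μ) (f : Ω → ℝ) : Prop where
  measurable : Measurable f
  bounded : ∃ M : ℝ, ∀ ω, |f ω| ≤ M
  exists_eq : ∀ x, ∃ y, U y =ᵐ[μ] fun ω => (f ω : 𝕜) * U x ω

namespace IsMultiplier

variable {U : H →ₗᵢ[𝕜] Lp 𝕜 2 μ} {f g : Ω → ℝ}

theorem const (c : ℝ) : IsMultiplier U fun _ => c where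
  measurable := measurable_const
  bounded := ⟨|c|, fun _ => le_rfl⟩
  exists_eq x := by
    refine ⟨(c : 𝕜) • x, ?_⟩
    rw [map_smul]
    filter_upwards [Lp.coeFn_smul (c : 𝕜) (U x)] with ω hω
    rw [hω, Pi.smul_apply, smul_eq_mul]

theorem add (hf : IsMultiplier U f) (hg : IsMultiplier U g) :
    IsMultiplier U fun ω => f ω + g ω where
  measurable := hf.measurable.add hg.measurable
  bounded := by
    obtain ⟨M, hM⟩ := hf.bounded
    obtain ⟨N, hN⟩ := hg.bounded
    exact ⟨M + N, fun ω => (abs_add_le _ _).trans (add_le_add (hM ω) (hN ω))⟩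
  exists_eq x := by
    obtain ⟨y, hy⟩ := hf.exists_eq x
    obtain ⟨z, hz⟩ := hg.exists_eq x
    refine ⟨y + z, ?_⟩
    rw [map_add]
    filter_upwards [Lp.coeFn_add (U y) (U z), hy, hz] with ω h1 h2 h3
    rw [h1, Pi.add_apply, h2, h3, RCLike.ofReal_add, add_mul]

theorem mul (hf : IsMultiplier U f) (hg : IsMultiplier U g) :
    IsMultiplier U fun ω => f ω * g ω where
  measurable := hf.measurable.mul hg.measurable
  bounded := by
    obtain ⟨M, hM⟩ := hf.bounded
    obtain ⟨N, hN⟩ := hg.bounded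
    refine ⟨M * N, fun ω => ?_⟩
    rw [abs_mul]
    exact mul_le_mul (hM ω) (hN ω) (abs_nonneg _) ((abs_nonneg _).trans (hM ω))
  exists_eq x := by
    obtain ⟨y, hy⟩ := hg.exists_eq x
    obtain ⟨z, hz⟩ := hf.exists_eq y
    refine ⟨z, ?_⟩
    filter_upwards [hy, hz] with ω h1 h2
    rw [h2, h1, RCLike.ofReal_mul, mul_assoc]

theorem polynomial_eval (hf : IsMultiplier U f) (p : Polynomial ℝ) :
    IsMultiplier U fun ω => p.eval (f ω) := by
  induction p using Polynomial.induction_on with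
  | C a => simpa using const a
  | add p q hp hq => simpa using hp.add hq
  | monomial n a h =>
    have := h.mul hf
    simpa [pow_succ, mul_assoc] using this

variable [CompleteSpace H]

/-- The products converge in `L²` by bounded convergence, and the range of `U` is closed because `H`
is complete. -/
theorem of_tendsto {ι : Type*} {l : Filter ι} [l.IsCountablyGenerated] [l.NeBot]
    {φ : ι → Ω → ℝ} (hφ : ∀ i, IsMultiplier U (φ i)) {M : ℝ} (hM : ∀ i ω, |φ i ω| ≤ M)
    (hlim : ∀ ω, Tendsto (fun i => φ i ω) l (𝓝 (f ω))) : IsMultiplier U f := by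
  have hf : Measurable f :=
    measurable_of_tendsto_metrizable' l (fun i => (hφ i).measurable) (tendsto_pi_nhds.2 hlim)
  have hfM : ∀ ω, |f ω| ≤ M := fun ω =>
    le_of_tendsto (hlim ω).abs (Eventually.of_forall fun i => hM i ω)
  refine ⟨hf, ⟨M, hfM⟩, fun x => ?_⟩
  choose y hy using fun i => (hφ i).exists_eq x
  have hmem : MemLp (fun ω => (f ω : 𝕜) * U x ω) 2 μ := by
    refine (Lp.memLp (U x)).of_le_mul (c := M) ?_ (Eventually.of_forall fun ω => ?_)
    · exact (RCLike.measurable_ofReal.comp hf).aestronglyMeasurable.mul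
        (Lp.aestronglyMeasurable (U x))
    · rw [norm_mul, RCLike.norm_ofReal]
      gcongr
      exact hfM ω
  have hG := hmem.coeFn_toLp
  have ht : Tendsto (fun i => U (y i)) l (𝓝 (hmem.toLp _)) :=
    Lp_two_tendsto_of_bounded_mul (fun i => (hφ i).measurable) hM hlim hy hG
  have hcl : IsClosed (range U) := U.isometry.isClosedEmbedding.isClosed_range
  obtain ⟨z, hz⟩ := hcl.mem_of_tendsto ht (Eventually.of_forall fun i => mem_range_self _)
  exact ⟨z, hz ▸ hG⟩

/-- The functions `min 1 (n t⁺)` increase to the indicator of `t > 0`. By Weierstrass each is within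
`1/(n+1)` of a polynomial on `[-M, M]`, and polynomials in `f` are multipliers. -/
theorem indicator_pos (hf : IsMultiplier U f) :
    IsMultiplier U ({ω | 0 < f ω}.indicator fun _ => 1) := by
  obtain ⟨M, hM⟩ := hf.bounded
  let ψ : ℕ → ℝ → ℝ := fun n t => min 1 (n * max t 0)
  have hψ : ∀ n, Continuous (ψ n) := fun n => by fun_prop
  have hψ0 : ∀ n t, 0 ≤ ψ n t := fun n t => by positivity
  have hψ1 : ∀ n t, ψ n t ≤ 1 := fun n t => min_le_left _ _
  choose p hp using fun n : ℕ => exists_polynomial_near_of_continuousOn (-M) M (ψ n)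
    (hψ n).continuousOn (1 / ((n : ℝ) + 1)) Nat.one_div_pos_of_nat
  have hp' : ∀ n ω, |(p n).eval (f ω) - ψ n (f ω)| < 1 / ((n : ℝ) + 1) := fun n ω =>
    hp n _ (abs_le.1 (hM ω))
  have hn1 : ∀ n : ℕ, 1 / ((n : ℝ) + 1) ≤ 1 := fun n => by
    rw [div_le_one (by positivity)]
    linarith [n.cast_nonneg (α := ℝ)]
  refine of_tendsto (l := atTop) (fun n => hf.polynomial_eval (p n)) (M := 2) ?_ ?_
  · intro n ω
    have h1 := abs_lt.1 (hp' n ω)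
    rw [abs_le]
    constructor <;> linarith [h1.1, h1.2, hn1 n, hψ0 n (f ω), hψ1 n (f ω)]
  · intro ω
    have h1 : Tendsto (fun n => ψ n (f ω)) atTop (𝓝 ({ω | 0 < f ω}.indicator (fun _ => 1) ω)) := by
      by_cases h : 0 < f ω
      · rw [indicator_of_mem (show ω ∈ {ω | 0 < f ω} from h)]
        refine tendsto_const_nhds.congr' ?_
        obtain ⟨N, hN⟩ := exists_nat_gt (1 / f ω)
        filter_upwards [eventually_ge_atTop N] with n hn
        have hn' : (N : ℝ) ≤ n := by exact_mod_cast hn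
        have : 1 ≤ n * f ω := by
          rw [div_lt_iff₀ h] at hN
          nlinarith
        simp [ψ, max_eq_left h.le, this]
      · rw [indicator_of_notMem (show ω ∉ {ω | 0 < f ω} from h)]
        simp [ψ, max_eq_right (not_lt.1 h)]
    have h2 : Tendsto (fun n => (p n).eval (f ω) - ψ n (f ω)) atTop (𝓝 0) :=
      squeeze_zero_norm (fun n => (hp' n ω).le) tendsto_one_div_add_atTop_nhds_zero_nat
    simpa using h2.add h1

/-- Since `r > 0`, the set `m > a` is where the multiplier `m r - a r` is positive. The half-lines
form a π-system generating the Borel sets, and a π-λ induction does the rest. -/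
theorem indicator_preimage {m r : Ω → ℝ} (hr0 : ∀ ω, 0 < r ω)
    (hr : IsMultiplier U r) (hmr : IsMultiplier U fun ω => m ω * r ω) {V : Set ℝ}
    (hV : MeasurableSet V) : IsMultiplier U ((m ⁻¹' V).indicator fun _ => 1) := by
  induction V, hV using MeasurableSpace.induction_on_inter
    (BorelSpace.measurable_eq.trans (borel_eq_generateFrom_Ioi ℝ)) isPiSystem_Ioi with
  | empty => simpa using const 0
  | basic V hV =>
    obtain ⟨a, rfl⟩ := hV
    convert (hmr.add ((const (-a)).mul hr)).indicator_pos using 2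
    ext ω
    have := hr0 ω
    simp only [mem_preimage, mem_Ioi, mem_ofPred_eq]
    rw [← add_mul, mul_pos_iff_of_pos_right this]
    constructor <;> intro <;> linarith
  | compl V hV h =>
    convert (const 1).add ((const (-1)).mul h) using 1
    ext ω
    by_cases hω : m ω ∈ V <;> simp [hω]
  | iUnion V hd hV h =>
    have hs : ∀ s : Finset ℕ, IsMultiplier U ((m ⁻¹' ⋃ n ∈ s, V n).indicator fun _ => 1) := by
      intro s
      induction s using Finset.induction_on with
      | empty => simpa using const 0
      | insert a s ha ih =>
        convert (h a).add ih using 1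
        ext ω
        rw [Finset.set_biUnion_insert, preimage_union, indicator_union_of_disjoint]
        refine Disjoint.preimage _ ?_
        simp only [disjoint_iUnion_right]
        exact fun i hi => hd (ne_of_mem_of_not_mem hi ha).symm
    refine of_tendsto (l := atTop) hs (M := 1) ?_ ?_
    · intro s ω
      by_cases hω : ω ∈ m ⁻¹' ⋃ n ∈ s, V n
      · rw [indicator_of_mem hω, abs_one]
      · rw [indicator_of_notMem hω, abs_zero]
        exact zero_le_one
    · intro ω
      refine tendsto_const_nhds.congr' ?_
      by_cases hω : ∃ n, m ω ∈ V n
      · obtain ⟨n, hn⟩ := hω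
        filter_upwards [eventually_ge_atTop {n}] with s hs
        rw [indicator_of_mem, indicator_of_mem]
        · exact mem_biUnion (hs (Finset.mem_singleton_self n)) hn
        · exact mem_iUnion.2 ⟨n, hn⟩
      · refine Eventually.of_forall fun s => ?_
        dsimp only
        have hω' : ω ∉ m ⁻¹' ⋃ n ∈ s, V n := by
          simp only [mem_preimage, mem_iUnion, not_exists]
          exact fun n _ hn => hω ⟨n, hn⟩
        rw [indicator_of_notMem, indicator_of_notMem hω']
        simpa using hω

end IsMultiplier

end Multiplier

/-! ### The compressed projection-valued measure and its integral. -/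

section Multiplication

variable {𝕜 H Ω : Type*} [RCLike 𝕜] [NormedAddCommGroup H] [InnerProductSpace 𝕜 H]
  [CompleteSpace H] [MeasurableSpace Ω] {μ : Measure Ω}
  {A : H →ₗ.[𝕜] H} {m : Ω → ℝ} {U : H →ₗᵢ[𝕜] Lp 𝕜 2 μ}

/-- The range of `U` reduces the spectral projections of the multiplication operator. -/
theorem isMultiplier_indicator_preimage (hA : IsSelfAdjoint A) (hm : Measurable m)
    (hU : ∀ x : A.domain, U (A x) =ᵐ[μ] fun ω => (m ω : 𝕜) * U x ω) {V : Set ℝ}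
    (hV : MeasurableSet V) : IsMultiplier U ((m ⁻¹' V).indicator fun _ => 1) := by
  have hpos : ∀ ω, 0 < 1 + m ω ^ 2 := fun ω => by positivity
  have hK : ∀ ω, (1 + (m ω : 𝕜) ^ 2) ≠ 0 := fun ω => by
    have := (hpos ω).ne'
    exact_mod_cast this
  -- With `x = a + A b` and `b = A a`, one has `U x = (1 + m²) U a`. Hence `r · U x = U a` and `m r
  -- · U x = U b`.
  refine IsMultiplier.indicator_preimage (r := fun ω => (1 + m ω ^ 2)⁻¹)
    (fun ω => inv_pos.2 (hpos ω)) ⟨by fun_prop, ⟨1, fun ω => ?_⟩, fun x => ?_⟩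
    ⟨by fun_prop, ⟨1, fun ω => ?_⟩, fun x => ?_⟩ hV
  · rw [abs_of_pos (inv_pos.2 (hpos ω))]
    exact inv_le_one_of_one_le₀ (by nlinarith [sq_nonneg (m ω)])
  · obtain ⟨a, b, hab, hx⟩ := hA.exists_add_apply_apply_eq x
    refine ⟨a, ?_⟩
    rw [← hx, map_add]
    have hb := hU a
    rw [hab] at hb
    filter_upwards [Lp.coeFn_add (U a) (U (A b)), hb, hU b] with ω h1 h2 h3
    rw [h1, Pi.add_apply, h3, h2]
    push_cast
    field_simp [hK ω]
  · rw [abs_mul, abs_of_pos (inv_pos.2 (hpos ω)), ← div_eq_mul_inv, div_le_one (hpos ω)]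
    nlinarith [sq_nonneg (|m ω| - 1), sq_abs (m ω), abs_nonneg (m ω)]
  · obtain ⟨a, b, hab, hx⟩ := hA.exists_add_apply_apply_eq x
    refine ⟨b, ?_⟩
    rw [← hx, map_add]
    have hb := hU a
    rw [hab] at hb
    filter_upwards [Lp.coeFn_add (U a) (U (A b)), hb, hU b] with ω h1 h2 h3
    rw [h1, Pi.add_apply, h3, h2]
    push_cast
    field_simp [hK ω]

/-- The set function `V ↦ U* 1_{m⁻¹ V} U`. -/
def compressedIndicator (μ : Measure Ω) {m : Ω → ℝ} (hm : Measurable m) (U : H →ₗᵢ[𝕜] Lp 𝕜 2 μ)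
    (V : Set ℝ) : H →L[𝕜] H :=
  open scoped Classical in
  if hV : MeasurableSet V then ContinuousLinearMap.adjoint U.toContinuousLinearMap ∘L
    indicatorOperator 𝕜 μ (hm hV) ∘L U.toContinuousLinearMap else 0

theorem compressedIndicator_of_measurableSet (hm : Measurable m) {V : Set ℝ}
    (hV : MeasurableSet V) :
    compressedIndicator μ hm U V = ContinuousLinearMap.adjoint U.toContinuousLinearMap ∘L
      indicatorOperator 𝕜 μ (hm hV) ∘L U.toContinuousLinearMap := dif_pos hV

theorem LinearIsometry.adjoint_apply_apply {E : Type*} [NormedAddCommGroup E]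
    [InnerProductSpace 𝕜 E] [CompleteSpace E] (W : H →ₗᵢ[𝕜] E) (x : H) :
    ContinuousLinearMap.adjoint W.toContinuousLinearMap (W x) = x := by
  refine ext_inner_right 𝕜 fun y => ?_
  rw [ContinuousLinearMap.adjoint_inner_left]
  exact W.inner_map_map x y

/-- `U U*` is the identity on the range of `U`, and multiplication by the indicator does not leave
that range. -/
theorem map_compressedIndicator (hA : IsSelfAdjoint A) (hm : Measurable m)
    (hU : ∀ x : A.domain, U (A x) =ᵐ[μ] fun ω => (m ω : 𝕜) * U x ω) {V : Set ℝ}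
    (hV : MeasurableSet V) (x : H) :
    U (compressedIndicator μ hm U V x) = indicatorOperator 𝕜 μ (hm hV) (U x) := by
  obtain ⟨y, hy⟩ := (isMultiplier_indicator_preimage hA hm hU hV).exists_eq x
  have h1 : indicatorOperator 𝕜 μ (hm hV) (U x) = U y := by
    refine Lp.ext ?_
    filter_upwards [hy, indicatorOperator_ae 𝕜 μ (hm hV) (U x)] with ω h1 h2
    rw [h1, h2]
    by_cases hω : m ω ∈ V <;> simp [hω]
  rw [compressedIndicator_of_measurableSet hm hV]
  simp only [ContinuousLinearMap.coe_comp, Function.comp_apply,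
    LinearIsometry.coe_toContinuousLinearMap]
  rw [h1, LinearIsometry.adjoint_apply_apply]

theorem map_compressedIndicator_ae (hA : IsSelfAdjoint A) (hm : Measurable m)
    (hU : ∀ x : A.domain, U (A x) =ᵐ[μ] fun ω => (m ω : 𝕜) * U x ω) {V : Set ℝ}
    (hV : MeasurableSet V) (x : H) :
    U (compressedIndicator μ hm U V x) =ᵐ[μ] (m ⁻¹' V).indicator (U x) := by
  rw [map_compressedIndicator hA hm hU hV]
  exact indicatorOperator_ae 𝕜 μ (hm hV) (U x)

theorem inner_compressedIndicator (hA : IsSelfAdjoint A) (hm : Measurable m)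
    (hU : ∀ x : A.domain, U (A x) =ᵐ[μ] fun ω => (m ω : 𝕜) * U x ω) {V : Set ℝ}
    (hV : MeasurableSet V) (x y : H) :
    inner 𝕜 (compressedIndicator μ hm U V x) y =
      ∫ ω in m ⁻¹' V, inner 𝕜 (U x ω) (U y ω) ∂μ := by
  rw [← U.inner_map_map, L2.inner_def, ← integral_indicator (hm hV)]
  refine integral_congr_ae ?_
  filter_upwards [map_compressedIndicator_ae hA hm hU hV x] with ω hω
  rw [hω]
  by_cases h : ω ∈ m ⁻¹' V
  · rw [indicator_of_mem h, indicator_of_mem h]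
  · rw [indicator_of_notMem h, indicator_of_notMem h, inner_zero_left]

/-- The projection-valued measure `V ↦ U* 1_{m⁻¹ V} U`. -/
def compressedProjectionValuedMeasure (hA : IsSelfAdjoint A) (hm : Measurable m)
    (hU : ∀ x : A.domain, U (A x) =ᵐ[μ] fun ω => (m ω : 𝕜) * U x ω) :
    ProjectionValuedMeasure 𝕜 H where
  toFun := compressedIndicator μ hm U
  not_measurable' V hV := dif_neg hV
  isStarProjection' V hV := by
    refine ⟨?_, ?_⟩
    · ext x
      refine U.injective (Lp.ext ?_)
      change U (compressedIndicator μ hm U V (compressedIndicator μ hm U V x)) =ᵐ[μ] _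
      filter_upwards [map_compressedIndicator_ae hA hm hU hV (compressedIndicator μ hm U V x),
        map_compressedIndicator_ae hA hm hU hV x] with ω h1 h2
      rw [h1, h2]
      by_cases h : ω ∈ m ⁻¹' V
      · rw [indicator_of_mem h, h2]
      · rw [indicator_of_notMem h, indicator_of_notMem h]
    · rw [ContinuousLinearMap.isSelfAdjoint_iff_isSymmetric]
      intro x y
      change inner 𝕜 (compressedIndicator μ hm U V x) y
        = inner 𝕜 x (compressedIndicator μ hm U V y)
      rw [← inner_conj_symm x, inner_compressedIndicator hA hm hU hV,
        inner_compressedIndicator hA hm hU hV, ← integral_conj]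
      simp_rw [inner_conj_symm]
  empty' := by
    ext x
    refine U.injective (Lp.ext ?_)
    filter_upwards [map_compressedIndicator_ae hA hm hU MeasurableSet.empty x,
      Lp.coeFn_zero 𝕜 2 μ] with ω h1 h2
    rw [h1, _root_.zero_apply, map_zero, h2, preimage_empty, indicator_empty]
    rfl
  univ' := by
    ext x
    refine U.injective (Lp.ext ?_)
    filter_upwards [map_compressedIndicator_ae hA hm hU MeasurableSet.univ x] with ω h1
    rw [h1, ContinuousLinearMap.id_apply, preimage_univ, indicator_univ]
  inter' V W hV hW := by
    ext x
    refine U.injective (Lp.ext ?_)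
    change _ =ᵐ[μ] U (compressedIndicator μ hm U V (compressedIndicator μ hm U W x))
    filter_upwards [map_compressedIndicator_ae hA hm hU hV (compressedIndicator μ hm U W x),
      map_compressedIndicator_ae hA hm hU hW x,
      map_compressedIndicator_ae hA hm hU (hV.inter hW) x] with ω h1 h2 h3
    rw [h1, h3, preimage_inter, ← indicator_indicator]
    by_cases h : ω ∈ m ⁻¹' V
    · rw [indicator_of_mem h, indicator_of_mem h, h2]
    · rw [indicator_of_notMem h, indicator_of_notMem h]
  hasSum' V hV hd x := by
    have hUn : ∀ s : Finset ℕ, MeasurableSet (⋃ n ∈ s, V n) := fun s =>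
      s.measurableSet_biUnion fun n _ => hV n
    have hdm : Pairwise (Function.onFun Disjoint fun n => m ⁻¹' V n) := fun i j hij =>
      (hd hij).preimage m
    -- In `L²` a partial sum is multiplication by the indicator of a finite union, which is
    -- pointwise eventually constant. Applying `U*` afterwards returns the sum to `H`.
    have key : HasSum (fun n => U (compressedIndicator μ hm U (V n) x))
        (U (compressedIndicator μ hm U (⋃ n, V n) x)) := by
      refine Lp_two_tendsto_of_bounded_mul (F := U x) (M := 1)
        (f := fun s : Finset ℕ => (m ⁻¹' ⋃ n ∈ s, V n).indicator fun _ => 1)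
        (g := (m ⁻¹' ⋃ n, V n).indicator fun _ => 1)
        (fun s => measurable_const.indicator (hm (hUn s))) ?_ ?_ ?_ ?_
      · intro s ω
        by_cases hω : ω ∈ m ⁻¹' ⋃ n ∈ s, V n
        · rw [indicator_of_mem hω, abs_one]
        · rw [indicator_of_notMem hω, abs_zero]
          exact zero_le_one
      · intro ω
        refine tendsto_const_nhds.congr' ?_
        by_cases hω : ∃ n, m ω ∈ V n
        · obtain ⟨n, hn⟩ := hω
          filter_upwards [eventually_ge_atTop {n}] with s hs
          rw [indicator_of_mem, indicator_of_mem]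
          · exact mem_biUnion (hs (Finset.mem_singleton_self n)) hn
          · exact mem_iUnion.2 ⟨n, hn⟩
        · refine Eventually.of_forall fun s => ?_
          dsimp only
          have hω' : ω ∉ m ⁻¹' ⋃ n ∈ s, V n := by
            simp only [mem_preimage, mem_iUnion, not_exists]
            exact fun n _ hn => hω ⟨n, hn⟩
          rw [indicator_of_notMem, indicator_of_notMem hω']
          simpa using hω
      · intro s
        have h1 : ∀ᵐ ω ∂μ, ∀ n, U (compressedIndicator μ hm U (V n) x) ω
            = (m ⁻¹' V n).indicator (U x) ω :=
          ae_all_iff.2 fun n => map_compressedIndicator_ae hA hm hU (hV n) x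
        filter_upwards [h1, Lp.coeFn_finsetSum s
          fun n => U (compressedIndicator μ hm U (V n) x)] with ω h2 h3
        rw [h3, Finset.sum_apply]
        simp_rw [h2]
        rw [← Finset.indicator_biUnion_apply s _ fun i _ j _ hij => hdm hij]
        simp only [preimage_iUnion]
        by_cases hω : ω ∈ ⋃ n ∈ s, m ⁻¹' V n
        · rw [indicator_of_mem hω, indicator_of_mem hω, RCLike.ofReal_one, one_mul]
        · rw [indicator_of_notMem hω, indicator_of_notMem hω, RCLike.ofReal_zero, zero_mul]
      · filter_upwards [map_compressedIndicator_ae hA hm hU (MeasurableSet.iUnion hV) x] with ω h1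
        rw [h1]
        by_cases hω : ω ∈ m ⁻¹' ⋃ n, V n
        · rw [indicator_of_mem hω, indicator_of_mem hω, RCLike.ofReal_one, one_mul]
        · rw [indicator_of_notMem hω, indicator_of_notMem hω, RCLike.ofReal_zero, zero_mul]
    have h2 := key.mapL (ContinuousLinearMap.adjoint U.toContinuousLinearMap)
    simpa only [LinearIsometry.adjoint_apply_apply] using h2

theorem diagMeasure_compressedProjectionValuedMeasure (hA : IsSelfAdjoint A) (hm : Measurable m)
    (hU : ∀ x : A.domain, U (A x) =ᵐ[μ] fun ω => (m ω : 𝕜) * U x ω) (x : H) :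
    (compressedProjectionValuedMeasure hA hm hU).diagMeasure x =
      (μ.withDensity fun ω => ‖U x ω‖ₑ ^ 2).map m := by
  ext V hV
  rw [Measure.map_apply hm hV, withDensity_apply _ (hm hV), ← lintegral_indicator (hm hV),
    ProjectionValuedMeasure.diagMeasure, Measure.ofMeasurable_apply V hV,
    ProjectionValuedMeasure.inner_apply_self _ hV, RCLike.ofReal_re, ← U.norm_map,
    ← lintegral_enorm_sq_eq_norm_sq]
  refine lintegral_congr_ae ?_
  filter_upwards [map_compressedIndicator_ae hA hm hU hV x] with ω hω
  change ‖U (compressedIndicator μ hm U V x) ω‖ₑ ^ 2 = _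
  rw [hω]
  by_cases h : ω ∈ m ⁻¹' V
  · rw [indicator_of_mem h, indicator_of_mem h]
  · rw [indicator_of_notMem h, indicator_of_notMem h]
    simp

theorem scalarMeasure_compressedProjectionValuedMeasure (hA : IsSelfAdjoint A) (hm : Measurable m)
    (hU : ∀ x : A.domain, U (A x) =ᵐ[μ] fun ω => (m ω : 𝕜) * U x ω) (x y : H) :
    (compressedProjectionValuedMeasure hA hm hU).scalarMeasure x y =
      (μ.withDensityᵥ fun ω => inner 𝕜 (U x ω) (U y ω)).map m := by
  ext V hV
  rw [VectorMeasure.map_apply _ hm hV, withDensityᵥ_apply (L2.integrable_inner _ _) (hm hV)]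
  exact inner_compressedIndicator hA hm hU hV x y

/-- A self-adjoint operator that embeds into a multiplication operator is the integral of the
identity with respect to the compressed projection-valued measure. -/
theorem isIntegral_compressedProjectionValuedMeasure (hA : IsSelfAdjoint A) (hm : Measurable m)
    (hU : ∀ x : A.domain, U (A x) =ᵐ[μ] fun ω => (m ω : 𝕜) * U x ω) :
    (compressedProjectionValuedMeasure hA hm hU).IsIntegral id A := by
  refine ⟨fun x => ?_, fun x y => ?_⟩
  · have hmeas : AEStronglyMeasurable (fun ω => (m ω : 𝕜) * U x ω) μ :=
      (RCLike.measurable_ofReal.comp hm).aestronglyMeasurable.mul (Lp.aestronglyMeasurable (U x))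
    have hmem : MemLp (fun ω => (m ω : 𝕜) * U x ω) 2 μ ↔
        ∫⁻ t, ‖id t‖ₑ ^ 2 ∂((compressedProjectionValuedMeasure hA hm hU).diagMeasure x) < ∞ := by
      rw [diagMeasure_compressedProjectionValuedMeasure, lintegral_map (by fun_prop) hm,
        lintegral_withDensity_eq_lintegral_mul₀ ((Lp.aestronglyMeasurable _).enorm.pow_const _)
          (by fun_prop), MemLp, and_iff_right hmeas,
        eLpNorm_lt_top_iff_lintegral_rpow_enorm_lt_top (by norm_num) (by norm_num)]
      have h0 : ∀ ω, ‖(m ω : 𝕜)‖ₑ = ‖m ω‖ₑ := fun ω =>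
        congrArg _ (NNReal.eq (RCLike.norm_ofReal _))
      simp [enorm_mul, mul_pow, h0, mul_comm]
    rw [← hmem]
    constructor
    · intro hx
      exact (Lp.memLp (U (A ⟨x, hx⟩))).ae_eq (hU ⟨x, hx⟩)
    · intro h
      -- The candidate for `A x` is `U*(m · U x)`: since `m` is real, it can be moved across the
      -- `L²` inner product onto `U d`, where it gives `U (A d)`.
      refine (hA.exists_apply_eq (y := x)
        (w := ContinuousLinearMap.adjoint U.toContinuousLinearMap (h.toLp _)) fun d => ?_).1
      rw [ContinuousLinearMap.adjoint_inner_left, ← U.inner_map_map x]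
      change inner 𝕜 (h.toLp _) (U d) = _
      rw [L2.inner_def, L2.inner_def]
      refine integral_congr_ae ?_
      filter_upwards [h.coeFn_toLp, hU d] with ω h1 h2
      rw [h1, h2]
      simp only [RCLike.inner_apply, map_mul, RCLike.conj_ofReal]
      ring
  · have hh := L2.integrable_inner (𝕜 := 𝕜) (U y) (U x)
    have hae : (fun ω => inner 𝕜 (U y ω) (U (A x) ω))
        =ᵐ[μ] fun ω => m ω • inner 𝕜 (U y ω) (U x ω) := by
      filter_upwards [hU x] with ω hω
      rw [hω]
      simp only [RCLike.inner_apply, RCLike.real_smul_eq_coe_mul]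
      ring
    have hi : Integrable (fun ω => m ω • inner 𝕜 (U y ω) (U x ω)) μ :=
      (L2.integrable_inner (𝕜 := 𝕜) (U y) (U (A x))).congr hae
    have hi' := (integrable_withDensityᵥ_iff hh hm).2 hi
    rw [scalarMeasure_compressedProjectionValuedMeasure]
    refine ⟨VectorMeasure.Integrable.map measurable_id.aestronglyMeasurable hi', ?_⟩
    rw [VectorMeasure.integral_map hm measurable_id.aestronglyMeasurable hi']
    simp only [id]
    rw [integral_withDensityᵥ hh hm hi, ← U.inner_map_map, L2.inner_def]
    exact integral_congr_ae hae

end Multiplication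

/-! ### Resolvents and finite-dimensional compressions. -/

section Hilbert

variable {𝕜 H : Type*} [RCLike 𝕜] [NormedAddCommGroup H] [InnerProductSpace 𝕜 H]

/-- Distinct vectors are at distance `√2 > 1`, so the balls of radius `1/2` around them are
disjoint. -/
theorem Orthonormal.countable_of_separableSpace [TopologicalSpace.SeparableSpace H] {ι : Type*}
    {v : ι → H} (hv : Orthonormal 𝕜 v) : Countable ι := by
  have hd : Pairwise (Function.onFun Disjoint fun i => Metric.ball (v i) (1 / 2)) := by
    intro i j hij
    refine Metric.ball_disjoint_ball ?_
    have h1 : ‖v i - v j‖ ^ 2 = 2 := by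
      rw [@norm_sub_sq 𝕜, hv.2 hij, hv.1 i, hv.1 j]
      norm_num
    rw [dist_eq_norm]
    nlinarith [norm_nonneg (v i - v j)]
  exact hd.countable_of_isOpen_disjoint (fun _ => Metric.isOpen_ball)
    fun i => ⟨v i, Metric.mem_ball_self (by norm_num)⟩

variable [CompleteSpace H] {A : H →ₗ.[𝕜] H}

theorem IsSelfAdjoint.inner_eq_of_add_apply_eq (hA : IsSelfAdjoint A) {x y : H}
    {a b a' b' : A.domain} (h1 : A a = b) (h2 : (a : H) + A b = x) (h1' : A a' = b')
    (h2' : (a' : H) + A b' = y) : inner 𝕜 (a : H) y = inner 𝕜 x (a' : H) := by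
  rw [← h2, ← h2', inner_add_left, inner_add_right, ← hA.inner_apply, hA.inner_apply b, h1, h1']

/-- Pairing `x = a + A b` with `a` gives `‖a‖² + ‖b‖² = Re ⟪a, x⟫`. The bound yields uniqueness of
`a`, `b` as well as continuity of `R` and `C`. -/
theorem IsSelfAdjoint.norm_le_of_add_apply_eq (hA : IsSelfAdjoint A) {x : H}
    {a b : A.domain} (h1 : A a = b) (h2 : (a : H) + A b = x) :
    ‖(a : H)‖ ≤ ‖x‖ ∧ ‖(b : H)‖ ≤ ‖x‖ := by
  have h3 : ‖(a : H)‖ ^ 2 + ‖(b : H)‖ ^ 2 = RCLike.re (inner 𝕜 (a : H) x) := by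
    rw [← h2, inner_add_right, ← hA.inner_apply, h1, map_add, inner_self_eq_norm_sq,
      inner_self_eq_norm_sq]
  have h4 : RCLike.re (inner 𝕜 (a : H) x) ≤ ‖(a : H)‖ * ‖x‖ := re_inner_le_norm _ _
  have ha := norm_nonneg (a : H)
  have hb := norm_nonneg (b : H)
  have hx := norm_nonneg x
  have h5 : ‖(a : H)‖ ≤ ‖x‖ := by
    by_contra h
    push Not at h
    nlinarith
  exact ⟨h5, by nlinarith⟩

/-- The bounded operators `R = (1 + A²)⁻¹` and `C = A (1 + A²)⁻¹`. -/
theorem IsSelfAdjoint.exists_resolvents (hA : IsSelfAdjoint A) :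
    ∃ R C : H →L[𝕜] H, (∀ x, ∃ a b : A.domain, (a : H) = R x ∧ (b : H) = C x ∧ A a = b ∧
      (a : H) + A b = x) ∧
      ∀ (x : H) (a b : A.domain), A a = b → (a : H) + A b = x → R x = a ∧ C x = b := by
  have huniq : ∀ (x : H) (a b a' b' : A.domain), A a = b → (a : H) + A b = x → A a' = b' →
      (a' : H) + A b' = x → a = a' ∧ b = b' := by
    intro x a b a' b' h1 h2 h1' h2'
    have h := hA.norm_le_of_add_apply_eq (x := 0) (a := a - a') (b := b - b')
      (by rw [A.map_sub, h1, h1', Submodule.coe_sub])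
      (by rw [A.map_sub, Submodule.coe_sub, ← sub_eq_zero.2 (h2.trans h2'.symm)]; abel)
    rw [norm_zero] at h
    exact ⟨Subtype.ext (sub_eq_zero.1 (norm_le_zero_iff.1 h.1)),
      Subtype.ext (sub_eq_zero.1 (norm_le_zero_iff.1 h.2))⟩
  choose a b h1 h2 using hA.exists_add_apply_apply_eq
  have hadd : ∀ x y, a (x + y) = a x + a y ∧ b (x + y) = b x + b y := fun x y =>
    huniq (x + y) _ _ _ _ (h1 _) (h2 _) (by rw [A.map_add, h1, h1, Submodule.coe_add])
      (by rw [A.map_add, Submodule.coe_add, add_add_add_comm, h2, h2])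
  have hsmul : ∀ (c : 𝕜) x, a (c • x) = c • a x ∧ b (c • x) = c • b x := fun c x =>
    huniq (c • x) _ _ _ _ (h1 _) (h2 _) (by rw [A.map_smul, h1, Submodule.coe_smul])
      (by rw [A.map_smul, Submodule.coe_smul, ← smul_add, h2])
  let R₀ : H →ₗ[𝕜] H :=
    { toFun := fun x => a x
      map_add' := fun x y => by rw [(hadd x y).1, Submodule.coe_add]
      map_smul' := fun c x => by rw [(hsmul c x).1, Submodule.coe_smul, RingHom.id_apply] }
  let C₀ : H →ₗ[𝕜] H :=
    { toFun := fun x => b x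
      map_add' := fun x y => by rw [(hadd x y).2, Submodule.coe_add]
      map_smul' := fun c x => by rw [(hsmul c x).2, Submodule.coe_smul, RingHom.id_apply] }
  refine ⟨R₀.mkContinuous 1 fun x => ?_, C₀.mkContinuous 1 fun x => ?_,
    fun x => ⟨a x, b x, rfl, rfl, h1 x, h2 x⟩, fun x a' b' h1' h2' => ?_⟩
  · rw [one_mul]
    exact (hA.norm_le_of_add_apply_eq (h1 x) (h2 x)).1
  · rw [one_mul]
    exact (hA.norm_le_of_add_apply_eq (h1 x) (h2 x)).2
  · obtain ⟨h3, h4⟩ := huniq x _ _ _ _ (h1 x) (h2 x) h1' h2'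
    exact ⟨congrArg Subtype.val h3, congrArg Subtype.val h4⟩

/-- Diagonalization of the compression of `A` to a finite-dimensional subspace of its domain. -/
theorem IsSelfAdjoint.exists_diagonal_compression (hA : IsSelfAdjoint A) (K : Submodule 𝕜 H)
    [FiniteDimensional 𝕜 K] (hK : K ≤ A.domain) :
    ∃ (n : ℕ) (v : Fin n → H) (l : Fin n → ℝ),
      (∀ (u : A.domain) (i : Fin n), (u : H) ∈ K →
        inner 𝕜 (v i) (A u) = (l i : 𝕜) * inner 𝕜 (v i) (u : H)) ∧
      ∀ x y, ∑ i, inner 𝕜 x (v i) * inner 𝕜 (v i) y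
        = inner 𝕜 (K.starProjection x) (K.starProjection y) := by
  let T : K →ₗ[𝕜] K :=
    (K.orthogonalProjectionOnto : H →ₗ[𝕜] K) ∘ₗ A.toFun ∘ₗ Submodule.inclusion hK
  have hTapp : ∀ u w : K, inner 𝕜 w (T u) = inner 𝕜 (w : H) (A (Submodule.inclusion hK u)) := by
    intro u w
    exact Submodule.inner_orthogonalProjectionOnto_eq_of_mem_left w _
  have hT : T.IsSymmetric := by
    intro u w
    rw [hTapp, ← inner_conj_symm, hTapp, inner_conj_symm]
    exact hA.inner_apply (Submodule.inclusion hK u) (Submodule.inclusion hK w)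
  let e := hT.eigenvectorBasis rfl
  refine ⟨_, fun i => (e i : H), hT.eigenvalues rfl, fun u i hu => ?_, fun x y => ?_⟩
  · have h1 := hTapp ⟨u, hu⟩ (e i)
    have h2 : Submodule.inclusion hK ⟨u, hu⟩ = u := rfl
    rw [h2] at h1
    rw [← h1, ← hT (e i), hT.apply_eigenvectorBasis, inner_smul_left, RCLike.conj_ofReal]
    rfl
  · have h := e.sum_inner_mul_inner (K.orthogonalProjectionOnto x) (K.orthogonalProjectionOnto y)
    rw [Submodule.starProjection_apply, Submodule.starProjection_apply, ← Submodule.coe_inner, ← h]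
    refine Finset.sum_congr rfl fun i _ => ?_
    rw [Submodule.inner_orthogonalProjectionOnto_eq_of_mem_right,
      Submodule.inner_orthogonalProjectionOnto_eq_of_mem_left]

end Hilbert

/-! ### Discrete measures and their weak limits. -/

section SumDirac

variable {Ω : Type*} [MeasurableSpace Ω]

/-- A finite sum of point masses. -/
def sumDirac {n : ℕ} (w : Fin n → NNReal) (p : Fin n → Ω) : FiniteMeasure Ω :=
  ⟨∑ i, w i • Measure.dirac (p i), inferInstance⟩

theorem mass_sumDirac {n : ℕ} (w : Fin n → NNReal) (p : Fin n → Ω) :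
    (sumDirac w p).mass = ∑ i, w i := by
  rw [← ENNReal.coe_inj, FiniteMeasure.ennreal_mass]
  change (∑ i, w i • Measure.dirac (p i)) univ = _
  rw [Measure.finsetSum_apply, ENNReal.ofNNReal_finsetSum]
  refine Finset.sum_congr rfl fun i _ => ?_
  rw [Measure.smul_apply, measure_univ, ENNReal.smul_def, smul_eq_mul, mul_one]

end SumDirac

section WeakLimit

variable {𝕜 Ω : Type*} [RCLike 𝕜] [TopologicalSpace Ω] [CompactSpace Ω] [T2Space Ω]
  [MeasurableSpace Ω] [BorelSpace Ω]

/-- Measures of mass at most `C` on a compact space form a weakly compact set, so an ultrafilter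
converges there. Scalar-valued integrands are split into real and imaginary parts. -/
theorem MeasureTheory.FiniteMeasure.exists_tendsto_integral {S : Type*} (𝒰 : Ultrafilter S)
    {ν : S → FiniteMeasure Ω} {C : NNReal} (hν : ∀ s, (ν s).mass ≤ C) :
    ∃ μ : FiniteMeasure Ω, ∀ f : Ω → 𝕜, Continuous f →
      Tendsto (fun s => ∫ ω, f ω ∂(ν s : Measure Ω)) 𝒰 (𝓝 (∫ ω, f ω ∂(μ : Measure Ω))) := by
  obtain ⟨μ, -, hμ⟩ := (isCompact_setOfPred_finiteMeasure_le_of_compactSpace Ω C).ultrafilter_le_nhds'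
    (𝒰.map ν) (Ultrafilter.mem_map.2 (Eventually.of_forall hν))
  have hreal := FiniteMeasure.tendsto_iff_forall_integral_tendsto.1 (show Tendsto ν 𝒰 (𝓝 μ) from hμ)
  refine ⟨μ, fun f hf => ?_⟩
  have hi : ∀ ρ : FiniteMeasure Ω, Integrable f (ρ : Measure Ω) := fun ρ =>
    hf.integrable_of_hasCompactSupport (HasCompactSupport.of_compactSpace f)
  simp_rw [← integral_re_add_im (hi _)]
  have h1 := hreal (BoundedContinuousFunction.mkOfCompact
    ⟨fun ω => RCLike.re (f ω), RCLike.continuous_re.comp hf⟩)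
  have h2 := hreal (BoundedContinuousFunction.mkOfCompact
    ⟨fun ω => RCLike.im (f ω), RCLike.continuous_im.comp hf⟩)
  exact ((RCLike.continuous_ofReal.tendsto _).comp h1).add
    (((RCLike.continuous_ofReal.tendsto _).comp h2).mul_const _)

theorem integral_sumDirac {n : ℕ} (w : Fin n → NNReal) (p : Fin n → Ω) {f : Ω → 𝕜}
    (hf : Continuous f) :
    ∫ ω, f ω ∂(sumDirac w p : Measure Ω) = ∑ i, (w i : ℝ) • f (p i) := by
  change ∫ ω, f ω ∂(∑ i, w i • Measure.dirac (p i)) = _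
  rw [integral_finsetSum_measure fun i _ =>
    hf.integrable_of_hasCompactSupport (HasCompactSupport.of_compactSpace f)]
  refine Finset.sum_congr rfl fun i _ => ?_
  rw [integral_smul_nnreal_measure, integral_dirac]
  rfl

end WeakLimit

/-! ### The compact space of spectral data and its measures. -/

section Model

variable {𝕜 : Type*} [RCLike 𝕜] {ι : Type*}

instance (ρ : ℝ) : CompactSpace (Metric.closedBall (0 : 𝕜) ρ) :=
  isCompact_iff_compactSpace.1 (isCompact_closedBall _ _)

/-- A compact space carrying two coordinates in `[-1, 1]` and a family of bounded scalars. -/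
abbrev SpectralModel (𝕜 : Type*) [RCLike 𝕜] {ι : Type*} (ρ : ι → ℝ) : Type _ :=
  Icc (-1 : ℝ) 1 × Icc (-1 : ℝ) 1 × ∀ k, Metric.closedBall (0 : 𝕜) (ρ k)

namespace SpectralModel

variable {ρ : ι → ℝ}

/-- The coordinate that carries the values of `1 / (1 + t²)`. -/
def rCoord (ω : SpectralModel 𝕜 ρ) : ℝ := ω.1

/-- The coordinate that carries the values of `t / (1 + t²)`. -/
def cCoord (ω : SpectralModel 𝕜 ρ) : ℝ := ω.2.1

/-- The coordinate that carries the values of the `k`-th vector. -/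
def vCoord (k : ι) (ω : SpectralModel 𝕜 ρ) : 𝕜 := ω.2.2 k

theorem continuous_rCoord : Continuous (rCoord : SpectralModel 𝕜 ρ → ℝ) :=
  continuous_subtype_val.comp continuous_fst

theorem continuous_cCoord : Continuous (cCoord : SpectralModel 𝕜 ρ → ℝ) :=
  continuous_subtype_val.comp (continuous_fst.comp continuous_snd)

theorem continuous_vCoord (k : ι) : Continuous (vCoord k : SpectralModel 𝕜 ρ → 𝕜) :=
  continuous_subtype_val.comp ((continuous_apply k).comp (continuous_snd.comp continuous_snd))

theorem abs_rCoord_le (ω : SpectralModel 𝕜 ρ) : |rCoord ω| ≤ 1 := abs_le.2 ω.1.2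

theorem abs_cCoord_le (ω : SpectralModel 𝕜 ρ) : |cCoord ω| ≤ 1 := abs_le.2 ω.2.1.2

theorem norm_vCoord_le (k : ι) (ω : SpectralModel 𝕜 ρ) : ‖vCoord k ω‖ ≤ ρ k :=
  mem_closedBall_zero_iff.1 (ω.2.2 k).2

/-- `q` has the moments of an operator that sends `h k` to `z k`. -/
structure HasMoments {H : Type*} [NormedAddCommGroup H] [InnerProductSpace 𝕜 H]
    (ν : Measure (SpectralModel 𝕜 ρ)) (h : ι → H) (q : SpectralModel 𝕜 ρ → ℝ) (z : ι → H)
    (j k : ι) : Prop where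
  inner_eq : ∫ ω, (q ω : 𝕜) * inner 𝕜 (vCoord j ω) (vCoord k ω) ∂ν = inner 𝕜 (h j) (z k)
  inner_self_eq : ∫ ω, (q ω : 𝕜) ^ 2 * inner 𝕜 (vCoord k ω) (vCoord k ω) ∂ν = inner 𝕜 (z k) (z k)

variable {H : Type*} [NormedAddCommGroup H] [InnerProductSpace 𝕜 H] [CompleteSpace H]
  {A : H →ₗ.[𝕜] H} [Countable ι]

/-- Each eigenvector `v i` of the compression to `K` contributes one atom, and the moments become
Parseval sums. Those with a factor `R h_k` or `C h_k` are exact because these vectors lie in `K`;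
the Gram matrix sees only the projections of the `h_k`. -/
theorem exists_finite_model (hA : IsSelfAdjoint A) {R C : H → H}
    (hRC : ∀ x, ∃ a b : A.domain, (a : H) = R x ∧ (b : H) = C x ∧ A a = b ∧ (a : H) + A b = x)
    {h : ι → H} (hh : ∀ k, ‖h k‖ = 1) {α : ι → ℝ} (hα : ∀ k, 0 < α k)
    (hsum : ∀ s : Finset ι, ∑ k ∈ s, α k ≤ 1) (hρ : ∀ k, ρ k = 1 / √(α k)) (s : Finset ι)
    (K : Submodule 𝕜 H) [FiniteDimensional 𝕜 K] (hK : K ≤ A.domain)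
    (hsK : ∀ k ∈ s, R (h k) ∈ K ∧ C (h k) ∈ K) :
    ∃ ν : FiniteMeasure (SpectralModel 𝕜 ρ), ν.mass ≤ 1 ∧ ∀ j ∈ s, ∀ k ∈ s,
      ∫ ω, inner 𝕜 (vCoord j ω) (vCoord k ω) ∂(ν : Measure (SpectralModel 𝕜 ρ))
        = inner 𝕜 (K.starProjection (h j)) (K.starProjection (h k)) ∧
      HasMoments (ν : Measure (SpectralModel 𝕜 ρ)) h rCoord (fun k => R (h k)) j k ∧
      HasMoments (ν : Measure (SpectralModel 𝕜 ρ)) h cCoord (fun k => C (h k)) j k := by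
  classical
  obtain ⟨n, v, l, hvl, hv⟩ := hA.exists_diagonal_compression K hK
  -- The vector coordinates are `⟪v i, h k⟫ / √(w i)`. This weight bounds them by `1 / √(α k)`
  -- independently of `K`, and keeps the total mass at most `∑ α k ≤ 1`.
  let w : Fin n → NNReal := fun i =>
    ⟨∑ k ∈ s, α k * ‖inner 𝕜 (v i) (h k)‖ ^ 2,
      Finset.sum_nonneg fun k _ => mul_nonneg (hα k).le (sq_nonneg _)⟩
  have hw : ∀ i, ∀ k ∈ s, α k * ‖inner 𝕜 (v i) (h k)‖ ^ 2 ≤ w i := fun i k hk =>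
    Finset.single_le_sum (f := fun k => α k * ‖inner 𝕜 (v i) (h k)‖ ^ 2)
      (fun k _ => mul_nonneg (hα k).le (sq_nonneg _)) hk
  let x : ι → Fin n → 𝕜 := fun k i =>
    if k ∈ s then inner 𝕜 (v i) (h k) / ((√(w i) : ℝ) : 𝕜) else 0
  have hx : ∀ k i, x k i ∈ Metric.closedBall (0 : 𝕜) (ρ k) := by
    intro k i
    rw [mem_closedBall_zero_iff, hρ]
    by_cases hk : k ∈ s
    · have h1 := hw i k hk
      have hsα := Real.sqrt_pos.2 (hα k)
      simp only [x, if_pos hk, norm_div, RCLike.norm_ofReal, abs_of_nonneg (Real.sqrt_nonneg _)]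
      rcases eq_or_lt_of_le (NNReal.coe_nonneg (w i)) with h0 | h0
      · rw [← h0, Real.sqrt_zero, div_zero]
        positivity
      · rw [div_le_div_iff₀ (Real.sqrt_pos.2 h0) hsα, one_mul]
        refine Real.le_sqrt_of_sq_le ?_
        rw [mul_pow, Real.sq_sqrt (hα k).le, mul_comm]
        exact h1
    · simp only [x, if_neg hk, norm_zero]
      positivity
  have hxx : ∀ i, ∀ j ∈ s, ∀ k ∈ s, ((w i : ℝ) : 𝕜) * inner 𝕜 (x j i) (x k i)
      = inner 𝕜 (h j) (v i) * inner 𝕜 (v i) (h k) := by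
    intro i j hj k hk
    simp only [x, if_pos hj, if_pos hk, RCLike.inner_apply, map_div₀, inner_conj_symm,
      RCLike.conj_ofReal]
    -- If `w i = 0`, positivity of `α k` forces `⟪v i, h k⟫ = 0`, so division by zero loses nothing.
    rcases eq_or_lt_of_le (NNReal.coe_nonneg (w i)) with h0 | h0
    · have h1 : ‖inner 𝕜 (v i) (h k)‖ ^ 2 ≤ 0 := by
        have := hw i k hk
        rw [← h0] at this
        exact nonpos_of_mul_nonpos_right this (hα k)
      have h2 : inner 𝕜 (v i) (h k) = 0 := by
        rw [← norm_eq_zero]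
        exact pow_eq_zero_iff two_ne_zero |>.1 (le_antisymm h1 (sq_nonneg _))
      simp [h2]
    · have h1 : ((√(w i) : ℝ) : 𝕜) ≠ 0 := by
        exact_mod_cast (Real.sqrt_pos.2 h0).ne'
      have h2 : ((w i : ℝ) : 𝕜) = ((√(w i) : ℝ) : 𝕜) * ((√(w i) : ℝ) : 𝕜) := by
        rw [← RCLike.ofReal_mul, Real.mul_self_sqrt h0.le]
      rw [h2]
      field_simp
  have hl : ∀ i, 0 < 1 + l i ^ 2 := fun i => by positivity
  have hr1 : ∀ i, (1 + l i ^ 2)⁻¹ ∈ Icc (-1 : ℝ) 1 := fun i => by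
    rw [mem_Icc, ← abs_le, abs_of_pos (inv_pos.2 (hl i))]
    exact inv_le_one_of_one_le₀ (by nlinarith [sq_nonneg (l i)])
  have hc1 : ∀ i, l i * (1 + l i ^ 2)⁻¹ ∈ Icc (-1 : ℝ) 1 := fun i => by
    rw [mem_Icc, ← abs_le, abs_mul, abs_of_pos (inv_pos.2 (hl i)), ← div_eq_mul_inv, div_le_one (hl i)]
    nlinarith [sq_nonneg (|l i| - 1), sq_abs (l i), abs_nonneg (l i)]
  let p : Fin n → SpectralModel 𝕜 ρ := fun i => (⟨_, hr1 i⟩, ⟨_, hc1 i⟩, fun k => ⟨x k i, hx k i⟩)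
  have hint : ∀ g : SpectralModel 𝕜 ρ → 𝕜, Continuous g → ∀ j ∈ s, ∀ k ∈ s,
      ∫ ω, g ω * inner 𝕜 (vCoord j ω) (vCoord k ω) ∂(sumDirac w p : Measure (SpectralModel 𝕜 ρ))
        = ∑ i, g (p i) * (inner 𝕜 (h j) (v i) * inner 𝕜 (v i) (h k)) := by
    intro g hg j hj k hk
    have hc : Continuous fun ω : SpectralModel 𝕜 ρ =>
        g ω * inner 𝕜 (vCoord j ω) (vCoord k ω) :=
      hg.mul ((continuous_vCoord j).inner (continuous_vCoord k))
    rw [integral_sumDirac w p hc]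
    refine Finset.sum_congr rfl fun i _ => ?_
    rw [← hxx i j hj k hk, RCLike.real_smul_eq_coe_mul, mul_left_comm]
    rfl
  have hmom : ∀ (q : SpectralModel 𝕜 ρ → ℝ) (z : ι → H), Continuous q → (∀ k ∈ s, z k ∈ K) →
      (∀ k ∈ s, ∀ i, inner 𝕜 (v i) (z k) = (q (p i) : 𝕜) * inner 𝕜 (v i) (h k)) →
      ∀ j ∈ s, ∀ k ∈ s,
        HasMoments (sumDirac w p : Measure (SpectralModel 𝕜 ρ)) h q z j k := by
    intro q z hq hz hqz j hj k hk
    have hq' : Continuous fun ω => (q ω : 𝕜) := RCLike.continuous_ofReal.comp hq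
    have hzk : K.starProjection (z k) = z k := Submodule.starProjection_eq_self_iff.2 (hz k hk)
    constructor
    · rw [hint _ hq' j hj k hk]
      have h1 := hv (h j) (z k)
      rw [hzk, Submodule.inner_starProjection_left_eq_right, hzk] at h1
      rw [← h1]
      refine Finset.sum_congr rfl fun i _ => ?_
      rw [hqz k hk]
      ring
    · have hq2 : Continuous fun ω => (q ω : 𝕜) ^ 2 := hq'.pow 2
      rw [hint _ hq2 k hk k hk]
      have h1 := hv (z k) (z k)
      rw [hzk] at h1
      rw [← h1]
      refine Finset.sum_congr rfl fun i _ => ?_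
      rw [← inner_conj_symm (z k), hqz k hk, map_mul, RCLike.conj_ofReal, inner_conj_symm]
      ring
  have hdiag : ∀ k ∈ s, ∀ i,
      inner 𝕜 (v i) (R (h k)) = ((rCoord (p i) : ℝ) : 𝕜) * inner 𝕜 (v i) (h k) ∧
      inner 𝕜 (v i) (C (h k)) = ((cCoord (p i) : ℝ) : 𝕜) * inner 𝕜 (v i) (h k) := by
    intro k hk i
    obtain ⟨a, b, ha, hb, hab, hx⟩ := hRC (h k)
    have h1 := hvl a i (ha ▸ (hsK k hk).1)
    have h2 := hvl b i (hb ▸ (hsK k hk).2)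
    have h3 : ((1 + l i ^ 2 : ℝ) : 𝕜) ≠ 0 := by exact_mod_cast (hl i).ne'
    -- Both `a` and `b = A a` lie in `K`, so the eigenvalue relation can be used twice on `h k = a +
    -- A b`, without error terms.
    have h4 : inner 𝕜 (v i) (h k) = ((1 + l i ^ 2 : ℝ) : 𝕜) * inner 𝕜 (v i) (a : H) := by
      rw [← hx, inner_add_right, h2, ← hab, h1]
      push_cast
      ring
    have h5 : ((rCoord (p i) : ℝ) : 𝕜) = ((1 + l i ^ 2 : ℝ) : 𝕜)⁻¹ := by
      rw [← RCLike.ofReal_inv]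
      rfl
    have h6 : ((cCoord (p i) : ℝ) : 𝕜) = (l i : 𝕜) * ((1 + l i ^ 2 : ℝ) : 𝕜)⁻¹ := by
      rw [← RCLike.ofReal_inv, ← RCLike.ofReal_mul]
      rfl
    rw [← ha, ← hb, ← hab, h1, h4, h5, h6]
    constructor
    · rw [inv_mul_cancel_left₀ h3]
    · rw [mul_assoc, inv_mul_cancel_left₀ h3]
  refine ⟨sumDirac w p, ?_, fun j hj k hk => ⟨?_, ?_, ?_⟩⟩
  · rw [mass_sumDirac, ← NNReal.coe_le_coe, NNReal.coe_sum]
    change ∑ i, ∑ k ∈ s, α k * ‖inner 𝕜 (v i) (h k)‖ ^ 2 ≤ 1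
    rw [Finset.sum_comm]
    refine (Finset.sum_le_sum fun k _ => ?_).trans (hsum s)
    rw [← Finset.mul_sum]
    refine mul_le_of_le_one_right (hα k).le ?_
    have h1 := congrArg RCLike.re (hv (h k) (h k))
    rw [inner_self_eq_norm_sq, map_sum] at h1
    have h2 : ∀ i, RCLike.re (inner 𝕜 (h k) (v i) * inner 𝕜 (v i) (h k))
        = ‖inner 𝕜 (v i) (h k)‖ ^ 2 := fun i => by
      rw [← inner_conj_symm, RCLike.conj_mul]
      norm_cast
    simp_rw [h2] at h1
    rw [h1]
    have h3 := K.norm_starProjection_apply_le (h k)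
    rw [hh] at h3
    exact pow_le_one₀ (norm_nonneg _) h3
  · have h1 := hint (fun _ => 1) continuous_const j hj k hk
    simp only [one_mul] at h1
    rw [h1, hv]
  · exact hmom rCoord _ continuous_rCoord (fun k hk => (hsK k hk).1)
      (fun k hk i => (hdiag k hk i).1) j hj k hk
  · exact hmom cCoord _ continuous_cCoord (fun k hk => (hsK k hk).2)
      (fun k hk i => (hdiag k hk i).2) j hj k hk

/-- Density of the span of the `R h_k` makes the projections onto the growing spaces `K s` converge
strongly to the identity. All integrands are continuous on the compact model, so the moments pass to
a weak limit. -/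
theorem exists_model (hA : IsSelfAdjoint A) {R C : H → H}
    (hRC : ∀ x, ∃ a b : A.domain, (a : H) = R x ∧ (b : H) = C x ∧ A a = b ∧ (a : H) + A b = x)
    {h : ι → H} (hh : ∀ k, ‖h k‖ = 1)
    (hR : (Submodule.span 𝕜 (range fun k => R (h k))).topologicalClosure = ⊤) :
    ∃ (ρ : ι → ℝ) (ν : FiniteMeasure (SpectralModel 𝕜 ρ)), ∀ j k,
      ∫ ω, inner 𝕜 (vCoord j ω) (vCoord k ω) ∂(ν : Measure (SpectralModel 𝕜 ρ))
        = inner 𝕜 (h j) (h k) ∧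
      HasMoments (ν : Measure (SpectralModel 𝕜 ρ)) h rCoord (fun k => R (h k)) j k ∧
      HasMoments (ν : Measure (SpectralModel 𝕜 ρ)) h cCoord (fun k => C (h k)) j k := by
  classical
  have := Encodable.ofCountable ι
  obtain ⟨α, hα, c, hc, hc1⟩ := posSumOfEncodable one_pos ι
  have hsum : ∀ s : Finset ι, ∑ k ∈ s, α k ≤ 1 := fun s =>
    (sum_le_hasSum s (fun k _ => (hα k).le) hc).trans hc1
  let K : Finset ι → Submodule 𝕜 H := fun s =>
    Submodule.span 𝕜 ((s.image fun k => R (h k)) ∪ s.image fun k => C (h k) : Finset H)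
  have hKmono : Monotone K := by
    intro s t hst
    refine Submodule.span_mono (Finset.coe_subset.2 ?_)
    exact Finset.union_subset_union (Finset.image_subset_image hst) (Finset.image_subset_image hst)
  have hKdom : ∀ s, K s ≤ A.domain := by
    intro s
    refine Submodule.span_le.2 fun z hz => ?_
    simp only [Finset.coe_union, Finset.coe_image, mem_union, mem_image] at hz
    rcases hz with ⟨k, -, rfl⟩ | ⟨k, -, rfl⟩
    · obtain ⟨a, b, ha, -⟩ := hRC (h k)
      exact ha ▸ a.2
    · obtain ⟨a, b, -, hb, -⟩ := hRC (h k)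
      exact hb ▸ b.2
  have hRK : ∀ s, ∀ k ∈ s, R (h k) ∈ K s := fun s k hk => Submodule.subset_span <|
    Finset.mem_coe.2 (Finset.mem_union_left _ (Finset.mem_image_of_mem (fun k => R (h k)) hk))
  have hCK : ∀ s, ∀ k ∈ s, C (h k) ∈ K s := fun s k hk => Submodule.subset_span <|
    Finset.mem_coe.2 (Finset.mem_union_right _ (Finset.mem_image_of_mem (fun k => C (h k)) hk))
  have hKfin : ∀ s, FiniteDimensional 𝕜 (K s) := fun s => FiniteDimensional.span_finset 𝕜 _
  have hKtop : ⊤ ≤ (⨆ s, K s).topologicalClosure := by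
    rw [← hR]
    refine Submodule.topologicalClosure_mono (Submodule.span_le.2 ?_)
    rintro _ ⟨k, rfl⟩
    exact Submodule.mem_iSup_of_mem {k} (hRK {k} k (Finset.mem_singleton_self k))
  let ρ : ι → ℝ := fun k => 1 / √(α k)
  choose ν hν1 hν using fun s : Finset ι => exists_finite_model (ρ := ρ) hA hRC hh hα hsum
    (fun _ => rfl) s (K s) (hKdom s) fun k hk => ⟨hRK s k hk, hCK s k hk⟩
  -- An ultrafilter finer than `atTop` gives convergence of all moments at once, while every fixed
  -- pair of indices eventually lies in `s`.
  let 𝒰 : Ultrafilter (Finset ι) := Ultrafilter.of atTop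
  have h𝒰 : (𝒰 : Filter (Finset ι)) ≤ atTop := Ultrafilter.of_le atTop
  obtain ⟨μ, hμ⟩ := FiniteMeasure.exists_tendsto_integral (𝕜 := 𝕜) 𝒰 hν1
  refine ⟨ρ, μ, fun j k => ?_⟩
  have hvv : Continuous fun ω : SpectralModel 𝕜 ρ => inner 𝕜 (vCoord j ω) (vCoord k ω) :=
    (continuous_vCoord j).inner (continuous_vCoord k)
  have hkk : Continuous fun ω : SpectralModel 𝕜 ρ => inner 𝕜 (vCoord k ω) (vCoord k ω) :=
    (continuous_vCoord k).inner (continuous_vCoord k)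
  have hrr : Continuous fun ω : SpectralModel 𝕜 ρ => ((rCoord ω : ℝ) : 𝕜) :=
    RCLike.continuous_ofReal.comp continuous_rCoord
  have hcc : Continuous fun ω : SpectralModel 𝕜 ρ => ((cCoord ω : ℝ) : 𝕜) :=
    RCLike.continuous_ofReal.comp continuous_cCoord
  have hev : ∀ᶠ s in (𝒰 : Filter (Finset ι)), j ∈ s ∧ k ∈ s := by
    refine h𝒰 ?_
    filter_upwards [eventually_ge_atTop {j, k}] with s hs
    exact ⟨hs (by simp), hs (by simp)⟩
  have hproj : ∀ i, Tendsto (fun s => (K s).starProjection (h i)) 𝒰 (𝓝 (h i)) := fun i =>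
    (Submodule.starProjection_tendsto_self K hKmono (h i) hKtop).mono_left h𝒰
  refine ⟨?_, ⟨?_, ?_⟩, ⟨?_, ?_⟩⟩
  · refine tendsto_nhds_unique (hμ _ hvv) (((hproj j).inner (hproj k)).congr' ?_)
    filter_upwards [hev] with s hs using (hν s j hs.1 k hs.2).1.symm
  · refine tendsto_nhds_unique (hμ _ (hrr.mul hvv)) (tendsto_const_nhds.congr' ?_)
    filter_upwards [hev] with s hs using (hν s j hs.1 k hs.2).2.1.inner_eq.symm
  · refine tendsto_nhds_unique (hμ _ ((hrr.pow 2).mul hkk)) (tendsto_const_nhds.congr' ?_)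
    filter_upwards [hev] with s hs using (hν s j hs.1 k hs.2).2.1.inner_self_eq.symm
  · refine tendsto_nhds_unique (hμ _ (hcc.mul hvv)) (tendsto_const_nhds.congr' ?_)
    filter_upwards [hev] with s hs using (hν s j hs.1 k hs.2).2.2.inner_eq.symm
  · refine tendsto_nhds_unique (hμ _ ((hcc.pow 2).mul hkk)) (tendsto_const_nhds.congr' ?_)
    filter_upwards [hev] with s hs using (hν s j hs.1 k hs.2).2.2.inner_self_eq.symm

end SpectralModel

end Model

/-! ### From moments to intertwining relations. -/

theorem HilbertBasis.ext_inner_left {𝕜 H ι : Type*} [RCLike 𝕜] [NormedAddCommGroup H]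
    [InnerProductSpace 𝕜 H] (b : HilbertBasis ι 𝕜 H) {x y : H}
    (h : ∀ k, inner 𝕜 (b k) x = inner 𝕜 (b k) y) : x = y :=
  b.repr.injective (lp.ext (funext fun k => by
    rw [b.repr_apply_apply, b.repr_apply_apply, h]))

section BoundedMultiplication

variable {𝕜 Ω : Type*} [RCLike 𝕜] [MeasurableSpace Ω] {μ : Measure Ω}

/-- Multiplication by a bounded measurable real function is a bounded operator on `L²`. -/
theorem exists_multiplication_clm {q : Ω → ℝ} (hq : Measurable q) {M : ℝ}
    (hM : ∀ ω, |q ω| ≤ M) :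
    ∃ T : Lp 𝕜 2 μ →L[𝕜] Lp 𝕜 2 μ, ∀ F, T F =ᵐ[μ] fun ω => (q ω : 𝕜) * F ω := by
  have hq' : MemLp (fun ω => (q ω : 𝕜)) ∞ μ :=
    memLp_top_of_bound (RCLike.measurable_ofReal.comp hq).aestronglyMeasurable M
      (Eventually.of_forall fun ω => by rw [RCLike.norm_ofReal]; exact hM ω)
  refine ⟨(ContinuousLinearMap.mul 𝕜 𝕜).holderL μ ∞ 2 2 (hq'.toLp _), fun F => ?_⟩
  have h := (ContinuousLinearMap.mul 𝕜 𝕜).coeFn_holder (r := 2) (hq'.toLp _) F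
  filter_upwards [h, hq'.coeFn_toLp] with ω h1 h2
  refine Eq.trans h1 ?_
  rw [h2]
  rfl

variable {H : Type*} [NormedAddCommGroup H] [InnerProductSpace 𝕜 H] [CompleteSpace H] {ι : Type*}

/-- An isometry intertwines a bounded operator with a multiplication operator if the matrix
coefficients and norms on a Hilbert basis agree. -/
theorem ae_eq_mul_of_inner_eq (b : HilbertBasis ι 𝕜 H) (U : H →ₗᵢ[𝕜] Lp 𝕜 2 μ) (R : H →L[𝕜] H)
    {q : Ω → ℝ} (hq : Measurable q) {M : ℝ} (hM : ∀ ω, |q ω| ≤ M)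
    (h1 : ∀ j k, ∫ ω, (q ω : 𝕜) * inner 𝕜 (U (b j) ω) (U (b k) ω) ∂μ = inner 𝕜 (b j) (R (b k)))
    (h2 : ∀ k, ∫ ω, (q ω : 𝕜) ^ 2 * inner 𝕜 (U (b k) ω) (U (b k) ω) ∂μ
      = inner 𝕜 (R (b k)) (R (b k))) (x : H) :
    U (R x) =ᵐ[μ] fun ω => (q ω : 𝕜) * U x ω := by
  obtain ⟨T, hT⟩ := exists_multiplication_clm (𝕜 := 𝕜) (μ := μ) hq hM
  have hadj : ∀ k, ContinuousLinearMap.adjoint U.toContinuousLinearMap (T (U (b k)))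
      = R (b k) := by
    intro k
    refine b.ext_inner_left fun j => ?_
    rw [ContinuousLinearMap.adjoint_inner_right, ← h1]
    change inner 𝕜 (U (b j)) _ = _
    rw [L2.inner_def]
    refine integral_congr_ae ?_
    filter_upwards [hT (U (b k))] with ω hω
    rw [hω]
    simp only [RCLike.inner_apply]
    ring
  have hnorm : ∀ k, inner 𝕜 (T (U (b k))) (T (U (b k))) = inner 𝕜 (R (b k)) (R (b k)) := by
    intro k
    rw [← h2, L2.inner_def]
    refine integral_congr_ae ?_
    filter_upwards [hT (U (b k))] with ω hω
    rw [hω]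
    simp only [RCLike.inner_apply, map_mul, RCLike.conj_ofReal]
    ring
  have hb : ∀ k, U (R (b k)) = T (U (b k)) := by
    intro k
    have h3 : ∀ y, inner 𝕜 (U y) (T (U (b k))) = inner 𝕜 y (R (b k)) := fun y => by
      rw [← hadj, ContinuousLinearMap.adjoint_inner_right]
      rfl
    -- The first moments only give `U* T U = R` on the basis. Equality of norms makes `‖U R b - T U
    -- b‖²` expand to zero, so `T U b` has no component outside the range of `U`.
    rw [← sub_eq_zero, ← inner_self_eq_zero (𝕜 := 𝕜), inner_sub_left, inner_sub_right,
      inner_sub_right, hnorm, h3, U.inner_map_map, ← inner_conj_symm (T (U (b k))), h3,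
      inner_conj_symm]
    ring
  have hall : U.toContinuousLinearMap ∘L R = T ∘L U.toContinuousLinearMap := by
    refine ContinuousLinearMap.ext_on
      (Submodule.dense_iff_topologicalClosure_eq_top.2 b.dense_span) ?_
    rintro _ ⟨k, rfl⟩
    exact hb k
  have hx : U (R x) = T (U x) := congrArg (fun S : H →L[𝕜] Lp 𝕜 2 μ => S x) hall
  rw [hx]
  exact hT (U x)

end BoundedMultiplication

/-! ### Existence of a multiplication model, and the theorem. -/

section SpectralTheorem

variable {𝕜 H : Type*} [RCLike 𝕜] [NormedAddCommGroup H] [InnerProductSpace 𝕜 H]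
  [CompleteSpace H] {A : H →ₗ.[𝕜] H}

open SpectralModel

/-- A self-adjoint operator on a separable Hilbert space embeds into a multiplication operator. -/
theorem IsSelfAdjoint.exists_multiplication_model [TopologicalSpace.SeparableSpace H]
    (hA : IsSelfAdjoint A) :
    ∃ (w : Set H) (ρ : w → ℝ) (μ : Measure (SpectralModel 𝕜 ρ)) (m : SpectralModel 𝕜 ρ → ℝ)
      (U : H →ₗᵢ[𝕜] Lp 𝕜 2 μ), Measurable m ∧
      ∀ x : A.domain, U (A x) =ᵐ[μ] fun ω => (m ω : 𝕜) * U x ω := by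
  obtain ⟨w, b, -⟩ := exists_hilbertBasis 𝕜 H
  have hw : Countable w := b.orthonormal.countable_of_separableSpace
  obtain ⟨R, C, hRC, huniq⟩ := hA.exists_resolvents
  have hRsymm : ∀ x y, inner 𝕜 (R x) y = inner 𝕜 x (R y) := by
    intro x y
    obtain ⟨a, b, h1, -, h3, h4⟩ := hRC x
    obtain ⟨a', b', h1', -, h3', h4'⟩ := hRC y
    rw [← h1, ← h1']
    exact hA.inner_eq_of_add_apply_eq h3 h4 h3' h4'
  have hRinj : ∀ x, R x = 0 → x = 0 := by
    intro x hx
    obtain ⟨a, b, h1, -, h3, h4⟩ := hRC x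
    have ha : a = 0 := Subtype.ext (h1.trans hx)
    have hb : b = 0 := Subtype.ext (by rw [← h3, ha, A.map_zero]; rfl)
    rw [← h4, ha, hb, A.map_zero]
    simp
  have hRtop : (Submodule.span 𝕜 (range fun k => R (b k))).topologicalClosure = ⊤ := by
    rw [Submodule.topologicalClosure_eq_top_iff, Submodule.eq_bot_iff]
    intro v hv
    refine hRinj v (b.ext_inner_left fun k => ?_)
    rw [inner_zero_right, ← hRsymm]
    exact (Submodule.mem_orthogonal _ v).1 hv _ (Submodule.subset_span ⟨k, rfl⟩)
  obtain ⟨ρ, ν, hν⟩ := exists_model hA hRC b.orthonormal.1 hRtop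
  let μ : Measure (SpectralModel 𝕜 ρ) := ν
  have hX : ∀ k, MemLp (vCoord k : SpectralModel 𝕜 ρ → 𝕜) 2 μ := fun k =>
    MemLp.of_bound (continuous_vCoord k).aestronglyMeasurable (ρ k)
      (Eventually.of_forall (norm_vCoord_le k))
  let X : w → Lp 𝕜 2 μ := fun k => (hX k).toLp _
  have hXae : ∀ k, X k =ᵐ[μ] vCoord k := fun k => (hX k).coeFn_toLp
  have hXX : ∀ j k, inner 𝕜 (X j) (X k) = inner 𝕜 (b j) (b k) := by
    intro j k
    rw [← (hν j k).1, L2.inner_def]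
    refine integral_congr_ae ?_
    filter_upwards [hXae j, hXae k] with ω h1 h2
    rw [h1, h2]
  have hXon : Orthonormal 𝕜 X := by
    classical
    rw [orthonormal_iff_ite]
    intro j k
    rw [hXX]
    exact orthonormal_iff_ite.1 b.orthonormal j k
  let U : H →ₗᵢ[𝕜] Lp 𝕜 2 μ :=
    hXon.orthogonalFamily.linearIsometry.comp b.repr.toLinearIsometry
  have hUb : ∀ k, U (b k) = X k := by
    classical
    intro k
    change hXon.orthogonalFamily.linearIsometry (b.repr (b k)) = X k
    rw [b.repr_self, OrthogonalFamily.linearIsometry_apply_single]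
    simp
  have hUX : ∀ k, U (b k) =ᵐ[μ] vCoord k := fun k => by rw [hUb]; exact hXae k
  have hmul : ∀ (S : H →L[𝕜] H) (q : SpectralModel 𝕜 ρ → ℝ), Continuous q → (∀ ω, |q ω| ≤ 1) →
      (∀ j k, HasMoments μ b q (fun k => S (b k)) j k) →
      ∀ x, U (S x) =ᵐ[μ] fun ω => (q ω : 𝕜) * U x ω := by
    intro S q hq hq1 hS
    refine ae_eq_mul_of_inner_eq b U S hq.measurable hq1 (fun j k => ?_) fun k => ?_
    · rw [← (hS j k).inner_eq]
      refine integral_congr_ae ?_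
      filter_upwards [hUX j, hUX k] with ω h1 h2
      rw [h1, h2]
    · rw [← (hS k k).inner_self_eq]
      refine integral_congr_ae ?_
      filter_upwards [hUX k] with ω h1
      rw [h1]
  have hUR := hmul R rCoord continuous_rCoord abs_rCoord_le fun j k => (hν j k).2.1
  have hUC := hmul C cCoord continuous_cCoord abs_cCoord_le fun j k => (hν j k).2.2
  have hZ : MeasurableSet {ω : SpectralModel 𝕜 ρ | rCoord ω = 0} :=
    continuous_rCoord.measurable (measurableSet_singleton 0)
  -- In the limit `r` may vanish, which corresponds to `t = ∞`. There `U R = r U` vanishes, and the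
  -- range of `R` is dense, so no `U x` charges this set.
  have hzero : indicatorOperator 𝕜 μ hZ ∘L U.toContinuousLinearMap = 0 := by
    refine ContinuousLinearMap.ext_on (Submodule.dense_iff_topologicalClosure_eq_top.2 hRtop) ?_
    rintro _ ⟨k, rfl⟩
    refine Lp.ext ?_
    filter_upwards [indicatorOperator_ae 𝕜 μ hZ (U (R (b k))), hUR (b k),
      Lp.coeFn_zero 𝕜 2 μ] with ω h1 h2 h3
    refine Eq.trans h1 (Eq.trans ?_ h3.symm)
    by_cases hω : ω ∈ {ω : SpectralModel 𝕜 ρ | rCoord ω = 0}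
    · rw [indicator_of_mem hω, h2, show rCoord ω = 0 from hω, RCLike.ofReal_zero, zero_mul]
      rfl
    · rw [indicator_of_notMem hω]
      rfl
  have hvanish : ∀ x, ∀ᵐ ω ∂μ, rCoord ω = 0 → U x ω = 0 := by
    intro x
    have h0 : indicatorOperator 𝕜 μ hZ (U x) = 0 :=
      congrArg (fun S : H →L[𝕜] Lp 𝕜 2 μ => S x) hzero
    have h1 := indicatorOperator_ae 𝕜 μ hZ (U x)
    rw [h0] at h1
    filter_upwards [h1, Lp.coeFn_zero 𝕜 2 μ] with ω h2 h3 hω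
    rw [h3, indicator_of_mem (show ω ∈ {ω : SpectralModel 𝕜 ρ | rCoord ω = 0} from hω)] at h2
    exact h2.symm
  refine ⟨w, ρ, μ, fun ω => cCoord ω / rCoord ω, U,
    continuous_cCoord.measurable.div continuous_rCoord.measurable, fun d => ?_⟩
  -- With `d = a + A b` and `b = A a`, the pair `b`, `d - a` solves the resolvent equation for `A
  -- d`. Hence `r · U (A d) = c · U d`, to be divided by `r`.
  have hRA : R (A d) = C d := by
    obtain ⟨a, b, h1, h2, h3, h4⟩ := hRC d
    have hAb : A b = (d : H) - a := eq_sub_of_add_eq' h4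
    rw [← h2]
    refine (huniq (A d) b (d - a) ?_ ?_).1
    · rw [hAb, Submodule.coe_sub]
    · rw [A.map_sub, h3, add_sub_cancel]
  filter_upwards [hUR (A d), hUC d, hvanish (A d)] with ω h1 h2 h3
  rw [hRA, h2] at h1
  by_cases hω : rCoord ω = 0
  · rw [h3 hω, hω, div_zero, RCLike.ofReal_zero, zero_mul]
  · have hω' : ((rCoord ω : ℝ) : 𝕜) ≠ 0 := by exact_mod_cast hω
    rw [RCLike.ofReal_div, div_mul_eq_mul_div, h1, mul_div_cancel_left₀ _ hω']

end SpectralTheorem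

end

theorem mainTheorem5 {𝕜 H : Type*} [RCLike 𝕜] [NormedAddCommGroup H] [InnerProductSpace 𝕜 H]
    [CompleteSpace H] [TopologicalSpace.SeparableSpace H]
    (A : H →ₗ.[𝕜] H) (hA : IsSelfAdjoint A) :
    (∃ P : ProjectionValuedMeasure 𝕜 H, P.IsIntegral id A) ∧
    (∀ {Ω : Type*} [MeasurableSpace Ω] (μ : Measure Ω) [IsProbabilityMeasure μ]
      (m : Ω → ℝ) (hm : Measurable m) (U : H →ₗᵢ[𝕜] Lp 𝕜 2 μ),
      (∀ x : A.domain, ∃ h : U x ∈ (multiplicationOperator 𝕜 μ m).domain,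
        multiplicationOperator 𝕜 μ m ⟨U x, h⟩ = U (A x)) →
      ∃ P : ProjectionValuedMeasure 𝕜 H,
        (∀ (V : Set ℝ) (hV : MeasurableSet V),
          P.toFun V = ContinuousLinearMap.adjoint U.toContinuousLinearMap ∘L
            indicatorOperator 𝕜 μ (hm hV) ∘L U.toContinuousLinearMap) ∧
        P.IsIntegral id A) := by
  refine ⟨?_, fun {Ω} _ μ _ m hm U hU => ?_⟩
  · obtain ⟨w, ρ, μ, m, U, hm, hU⟩ := hA.exists_multiplication_model
    exact ⟨_, isIntegral_compressedProjectionValuedMeasure hA hm hU⟩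
  · have hU' : ∀ x : A.domain, U (A x) =ᵐ[μ] fun ω => (m ω : 𝕜) * U x ω := by
      intro x
      obtain ⟨h, hx⟩ := hU x
      rw [← hx]
      exact multiplicationOperator_ae 𝕜 μ m ⟨U x, h⟩
    exact ⟨compressedProjectionValuedMeasure hA hm hU',
      fun V hV => compressedIndicator_of_measurableSet hm hV,
      isIntegral_compressedProjectionValuedMeasure hA hm hU'⟩
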